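/- Let $\mathbb{T}$ be the unit circle, let $m$ be the normalized arc length measure $|d\zeta|/2\pi$ on $\mathbb{T}$, and let $\mu$ be a positive finite Borel measure on $\mathbb{T}$. For a Borel function $f:\mathbb{T}\to\mathbb{C}$ put $$\mathcal{D}_\mu(f)=\int_{\mathbb{T}}\int_{\mathbb{T}}\left|\frac{f(\zeta)-f(\xi)}{\zeta-\xi}\right|^2dm(\zeta)\,d\mu(\xi),\qquad \|f\|_\mu^2=\int_{\mathbb{T}}|f|^2\,dm+\mathcal{D}_\mu(f).$$ Let $\mathcal{D}^h(\mu)$ be the set of Borel functions $f\in L^2(\mathbb{T},m)$ with $\mathcal{D}_\mu(f)<\infty$, and let $\mathcal{D}(\mu)$ be the set of those $f\in\mathcal{D}^h(\mu)$ whose Fourier coefficients $\widehat f(n)=\int_{\mathbb{T}} f(\zeta)\zeta^{-n}\,dm(\zeta)$ vanish for all $n<0$. (For $f\in\mathcal{D}(\mu)$ and $\mu$-almost every $\xi$, the value $f(\xi)$ is the non-tangential limit at $\xi$ of $z\mapsto\sum_{n\ge0}\widehat f(n)z^n$.) For $A\subset\mathbb{T}$ let $$c_\mu(A)=\inf\left\{\|f\|_\mu^2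 : f\in\mathcal{D}^h(\mu),\ |f|\ge1\ m\text{-a.e. on an open neighbourhood of }A\right\};$$ a property holds $c_\mu$-q.e. on a set if it holds at all points of the set outside some $N\subset\mathbb{T}$ with $c_\mu(N)=0$. For real numbers $a<b\le a+2\pi$ let $I=(e^{ia},e^{ib})=\{e^{it}:a<t<b\}$ be the corresponding open arc, of length $|I|=b-a$, and for $\gamma>1$ let $$\gamma I=\left\{e^{it}: a-(\gamma-1)\tfrac{b-a}{2}<t<b+(\gamma-1)\tfrac{b-a}{2}\right\}.$$ **Theorem.** Let $E$ be a Borel subset of $\mathbb{T}$. Suppose that there are a number $\gamma>1$ and a sequence $(I_n)_{n\ge0}$ of non-empty open arcs such that the arcs $\gamma I_n$ are pairwise disjoint and $$\sum_{n}|I_n|\log\frac{|I_n|}{c_\mu(E\cap I_n)}=-\infty,$$ in the sense that the partial sums tend to $-\infty$, where a term with $c_\mu(E\cap I_n)=0$ has the value $+\infty$. Then $E$ is a uniqueness set for $\mathcal{D}(\mu)$: if $f\in\mathcal{D}(\mu)$ and, for $c_\mu$-q.e. $\zeta\in E$, the function $z\mapsto\sum_{n\ge0}\widehat f(n)z^n$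 on the unit disc has a non-tangential limit at $\zeta$ which is equal to $0$, then $f=0$ $m$-almost everywhere. -/

import Mathlib

open MeasureTheory Filter Topology
open scoped ENNReal

namespace HarmonicDirichlet

noncomputable section

/-- The Borel σ-algebra of the unit circle `Circle = {ζ ∈ ℂ : |ζ| = 1}`. -/
instance instMeasurableSpaceCircle : MeasurableSpace Circle := borel Circle

instance instBorelSpaceCircle : BorelSpace Circle := ⟨rfl⟩

/-- The normalized arc length measure `|dζ| / 2π` on the unit circle: the image under
`t ↦ exp (i t)` of the Haar probability measure of `ℝ / 2πℤ`. -/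
def arcMeasure : Measure Circle :=
  haveI : Fact (0 < 2 * Real.pi) := ⟨Real.two_pi_pos⟩
  (AddCircle.haarAddCircle (T := 2 * Real.pi)).map AddCircle.homeomorphCircle'

/-- The local Dirichlet integral
`𝒟_ξ(f) = ∫ |(f(ζ) - f(ξ)) / (ζ - ξ)|² |dζ| / 2π`, with values in `[0, ∞]`. -/
def localDirichlet (f : Circle → ℂ) (ξ : Circle) : ℝ≥0∞ :=
  ∫⁻ ζ, ‖(f ζ - f ξ) / ((ζ : ℂ) - (ξ : ℂ))‖ₑ ^ 2 ∂arcMeasure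

/-- The weighted Dirichlet integral `𝒟_μ(f) = ∫ 𝒟_ξ(f) dμ(ξ)`. -/
def dirichletIntegral (μ : Measure Circle) (f : Circle → ℂ) : ℝ≥0∞ :=
  ∫⁻ ξ, localDirichlet f ξ ∂μ

/-- The squared norm `‖f‖_μ² = ‖f‖²_{L²(𝕋)} + 𝒟_μ(f)`. -/
def normSq (μ : Measure Circle) (f : Circle → ℂ) : ℝ≥0∞ :=
  (∫⁻ ζ, ‖f ζ‖ₑ ^ 2 ∂arcMeasure) + dirichletIntegral μ f

/-- The harmonically weighted Dirichlet space `𝒟ʰ(μ)`: the square integrable Borel functions on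
the circle with finite weighted Dirichlet integral.  The functions are defined at every point,
because `𝒟_μ` sees the values `f(ξ)` for `μ`-almost every `ξ`.  (There is no freedom in these
values: for given `ξ` and given `f` up to arc length almost everywhere, at most one value `f(ξ)`
makes `𝒟_ξ(f)` finite, and it is the non-tangential limit at `ξ` of the Poisson integral
of `f`.) -/
def harmonicSpace (μ : Measure Circle) : Set (Circle → ℂ) :=
  {f | Measurable f ∧ MemLp f 2 arcMeasure ∧ dirichletIntegral μ f < ∞}

/-- The Fourier coefficient `f̂(n) = ∫ f(ζ) ζ^{-n} |dζ| / 2π`. -/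
def fourierCoefficient (f : Circle → ℂ) (n : ℤ) : ℂ :=
  ∫ ζ, f ζ * (ζ : ℂ) ^ (-n) ∂arcMeasure

/-- The analytic weighted Dirichlet space `𝒟(μ)`. -/
def analyticSpace (μ : Measure Circle) : Set (Circle → ℂ) :=
  {f | f ∈ harmonicSpace μ ∧ ∀ n : ℤ, n < 0 → fourierCoefficient f n = 0}

/-- The function `z ↦ ∑_{n ≥ 0} f̂(n) zⁿ` on the unit disc, with which an `f ∈ L²(𝕋)` whose
negative Fourier coefficients vanish is identified as an element of the Hardy space `H²`. -/
def discExtension (f : Circle → ℂ) (z : ℂ) : ℂ :=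
  ∑' n : ℕ, fourierCoefficient f n * z ^ n

/-- The non-tangential approach region (Stolz angle) of aperture `κ` with vertex `ζ`. -/
def approachRegion (κ : ℝ) (ζ : Circle) : Set ℂ :=
  {z | ‖z‖ < 1 ∧ ‖z - (ζ : ℂ)‖ < κ * (1 - ‖z‖)}

/-- `F`, a function on the unit disc, has non-tangential limit `l` at `ζ`. -/
def HasNontangentialLimit (F : ℂ → ℂ) (ζ : Circle) (l : ℂ) : Prop :=
  ∀ κ : ℝ, 1 < κ → Tendsto F (𝓝[approachRegion κ ζ] (ζ : ℂ)) (𝓝 l)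

/-- The capacity `c_μ(E)`: the infimum of `‖f‖_μ²` over the `f ∈ 𝒟ʰ(μ)` with `|f| ≥ 1` almost
everywhere (for arc length) on a neighbourhood of `E`. -/
def capacity (μ : Measure Circle) (E : Set Circle) : ℝ≥0∞ :=
  sInf {c | ∃ f ∈ harmonicSpace μ,
    (∃ U : Set Circle, IsOpen U ∧ E ⊆ U ∧ ∀ᵐ ζ ∂arcMeasure, ζ ∈ U → 1 ≤ ‖f ζ‖) ∧
      c = normSq μ f}

/-- `P` holds `c_μ`-quasi-everywhere on `E`. -/
def QuasiEverywhereOn (μ : Measure Circle) (E : Set Circle) (P : Circle → Prop) : Prop :=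
  ∃ N : Set Circle, capacity μ N = 0 ∧ ∀ ζ ∈ E, ζ ∉ N → P ζ

/-- `E` is a uniqueness set for `𝒟(μ)`: every `f ∈ 𝒟(μ)` whose non-tangential limit exists and
vanishes `c_μ`-quasi-everywhere on `E` is the zero function. -/
def IsUniquenessSet (μ : Measure Circle) (E : Set Circle) : Prop :=
  ∀ f ∈ analyticSpace μ,
    QuasiEverywhereOn μ E (fun ζ => HasNontangentialLimit (discExtension f) ζ 0) →
      f =ᵐ[arcMeasure] 0

/-- The open arc `(e^{ia}, e^{ib})`; for `a < b ≤ a + 2π` its length is `b - a`. -/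
def arc (a b : ℝ) : Set Circle :=
  Circle.exp '' Set.Ioo a b

/-- The enlargement `γ I` of the arc `I = (e^{ia}, e^{ib})`. -/
def enlargedArc (γ a b : ℝ) : Set Circle :=
  arc (a - (γ - 1) * ((b - a) / 2)) (b + (γ - 1) * ((b - a) / 2))

/-- `|I| log (|I| / c_μ(E ∩ I))` for `I = (e^{ia}, e^{ib})`, `|I| = b - a > 0`, as an extended
real number: it is `+∞` when `c_μ(E ∩ I) = 0`. -/
def capacityTerm (μ : Measure Circle) (E : Set Circle) (a b : ℝ) : EReal :=
  ((b - a : ℝ) : EReal) * ENNReal.log (ENNReal.ofReal (b - a) / capacity μ (E ∩ arc a b))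

end

end HarmonicDirichlet

/-!
# Uniqueness sets for harmonically weighted Dirichlet spaces

Let `f ∈ 𝒟(μ)` vanish quasi-everywhere on `E`, let `J = γ I`, and let `m_J` be the mean of `|f|`
over `J`.  The heart of the matter is the local estimate

`c_μ(E ∩ I) m_J² ≤ K(γ) D_J(f)`,
`D_J(f) = ∫_J |f|² dm + ∫_𝕋 ∫_J |(f ζ - f ξ) / (ζ - ξ)|² dm(ζ) dμ(ξ)`  (`localEnergy`),

in which `ξ` runs over the whole circle and only `ζ` is localized.  Because of this choice the
energies of disjoint arcs still add up to at most `‖f‖_μ²` (`sum_localEnergy_le_normSq`), while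
`D_J(f)` controls the interaction of a function supported in `J` with the masses of `μ` far from
`J`.  The test function is `χ (m_J - |f|) / m_J` with a Lipschitz cutoff `χ` of `I` in `J`: since
`m_J - |f|` has mean zero on `J`, every error term produced by `χ` is bounded by
`∫_J |f ζ - f ξ|² dm(ζ)`, for each `ξ` separately (`normSq_cutoff_mul_le`, `capacity_sublevel_le`).

This test function is admissible for continuous `f` only.  The passage to `𝒟(μ)`
(`capacity_inter_le`) uses the dilations `f_r`, which tend to `0` on `E` quasi-everywhere by
hypothesis.  They converge to `f` in `𝒟(μ)` (`tendsto_normSq_dilation_sub`), since the difference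
quotient of `f_r` at `ξ` is `r` times the dilated Cauchy projection of the difference quotient of
`f` times a weight that is bounded by `2` and tends to `1` (`diffQuot_dilation`).  As the capacity is
countably subadditive (`capacity_iUnion_le`) and satisfies a weak type inequality
(`capacity_lt_norm_le`), a fast converging sequence of dilations is uniformly small on `E ∩ I`
outside a set of small capacity.

If `f ≠ 0`, Jensen's inequality bounds `∫ log (|f| + ε) dm` from below uniformly in `ε`
(`exists_le_integral_log_norm_add`), hence, `log` being concave, the sums `∑ |I_n| log m_{J_n}` are
bounded below (`mean_pos_and_sum_measure_mul_log_mean_ge`).  By the local estimate and `log x ≤ x`,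
`|I_n| log (|I_n| / c_μ(E ∩ I_n)) ≥ 2 |I_n| log m_{J_n} - K D_{J_n}(f)` (`le_capacityTerm`), so the
partial sums of the series in the hypothesis are bounded below, and they cannot tend to `-∞`.
-/

namespace HarmonicDirichlet

noncomputable section

/-! ### Arc length measure and Fourier coefficients -/

instance instFactTwoPiPos : Fact (0 < 2 * Real.pi) := ⟨Real.two_pi_pos⟩

lemma measurePreserving_homeomorphCircle :
    MeasurePreserving (AddCircle.homeomorphCircle' : AddCircle (2 * Real.pi) → Circle)
      AddCircle.haarAddCircle arcMeasure :=
  ⟨AddCircle.homeomorphCircle'.continuous.measurable, rfl⟩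

lemma measurableEmbedding_homeomorphCircle :
    MeasurableEmbedding (AddCircle.homeomorphCircle' : AddCircle (2 * Real.pi) → Circle) :=
  AddCircle.homeomorphCircle'.measurableEmbedding

instance instIsProbabilityMeasureArcMeasure : IsProbabilityMeasure arcMeasure := by
  rw [← measurePreserving_homeomorphCircle.map_eq]
  exact Measure.isProbabilityMeasure_map measurePreserving_homeomorphCircle.measurable.aemeasurable

lemma toCircle_eq_homeomorphCircle (x : AddCircle (2 * Real.pi)) :
    AddCircle.toCircle x = AddCircle.homeomorphCircle' x := by
  induction x using QuotientAddGroup.induction_on with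
  | H t =>
    rw [AddCircle.homeomorphCircle'_apply_mk, AddCircle.toCircle_apply_mk]
    congr 1
    field_simp

lemma integral_arcMeasure_eq {F : Type*} [NormedAddCommGroup F] [NormedSpace ℝ F]
    (h : Circle → F) (t : ℝ) :
    ∫ ζ, h ζ ∂arcMeasure = (2 * Real.pi)⁻¹ • ∫ θ in t..t + 2 * Real.pi, h (Circle.exp θ) := by
  rw [← measurePreserving_homeomorphCircle.integral_comp measurableEmbedding_homeomorphCircle,
    AddCircle.integral_haarAddCircle, ← AddCircle.intervalIntegral_preimage (2 * Real.pi) t]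
  rfl

lemma circleAverage_eq_integral_arcMeasure (h : ℂ → ℝ) (r : ℝ) :
    Real.circleAverage h 0 r = ∫ ζ : Circle, h (r * (ζ : ℂ)) ∂arcMeasure := by
  rw [integral_arcMeasure_eq _ 0, Real.circleAverage_def]
  simp [circleMap]

lemma fourierCoefficient_eq (f : Circle → ℂ) (n : ℤ) :
    fourierCoefficient f n = fourierCoeff (f ∘ AddCircle.homeomorphCircle') n := by
  unfold fourierCoefficient fourierCoeff
  rw [← measurePreserving_homeomorphCircle.integral_comp measurableEmbedding_homeomorphCircle]
  congr 1 with x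
  rw [fourier_apply, AddCircle.toCircle_zsmul, toCircle_eq_homeomorphCircle]
  simp [mul_comm]

lemma lintegral_enorm_sq_lt_top_iff {α : Type*} [MeasurableSpace α] {ν : Measure α} {f : α → ℂ}
    (hf : AEStronglyMeasurable f ν) : MemLp f 2 ν ↔ ∫⁻ x, ‖f x‖ₑ ^ 2 ∂ν < ∞ := by
  rw [memLp_two_iff_integrable_sq_norm hf]
  constructor
  · intro h
    have := h.2
    simpa [HasFiniteIntegral, enorm_pow] using! this
  · intro h
    refine ⟨(hf.norm.pow 2), ?_⟩
    simpa [HasFiniteIntegral, enorm_pow] using! h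

lemma hasSum_sq_fourierCoeff_of_memLp {T : ℝ} [Fact (0 < T)] {f : AddCircle T → ℂ}
    (hf : MemLp f 2 (AddCircle.haarAddCircle (T := T))) :
    HasSum (fun n => ‖fourierCoeff f n‖ ^ 2) (∫ t, ‖f t‖ ^ 2 ∂AddCircle.haarAddCircle) := by
  have h1 := hasSum_sq_fourierCoeff (MemLp.toLp f hf)
  have h2 := MemLp.coeFn_toLp hf
  have h3 : ∫ t, ‖(MemLp.toLp f hf : AddCircle T → ℂ) t‖ ^ 2 ∂AddCircle.haarAddCircle
      = ∫ t, ‖f t‖ ^ 2 ∂AddCircle.haarAddCircle := by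
    refine integral_congr_ae ?_
    filter_upwards [h2] with x hx
    rw [hx]
  have h4 := fourierCoeff_congr_ae h2
  simp only [h4, h3] at h1
  exact h1
lemma lintegral_enorm_sq_eq_tsum_fourierCoeff {T : ℝ} [Fact (0 < T)] {f : AddCircle T → ℂ}
    (hf : MemLp f 2 (AddCircle.haarAddCircle (T := T))) :
    ∫⁻ x, ‖f x‖ₑ ^ 2 ∂AddCircle.haarAddCircle = ∑' n : ℤ, ‖fourierCoeff f n‖ₑ ^ 2 := by
  have h1 := hasSum_sq_fourierCoeff_of_memLp hf
  have hi : Integrable (fun ζ => ‖f ζ‖ ^ 2) AddCircle.haarAddCircle :=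
    (memLp_two_iff_integrable_sq_norm hf.1).1 hf
  have h4 := ofReal_integral_eq_lintegral_ofReal hi (Eventually.of_forall fun _ => by positivity)
  have h5 : ∀ z : ℂ, ENNReal.ofReal (‖z‖ ^ 2) = ‖z‖ₑ ^ 2 := fun z => by
    rw [ENNReal.ofReal_pow (norm_nonneg _), ofReal_norm]
  simp only [h5] at h4
  rw [← h4, ← h1.tsum_eq, ENNReal.ofReal_tsum_of_nonneg (fun _ => by positivity) h1.summable]
  simp only [h5]

/-- Parseval's identity on the circle. -/
lemma lintegral_enorm_sq_eq_tsum {f : Circle → ℂ} (hf : MemLp f 2 arcMeasure) :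
    ∫⁻ ζ, ‖f ζ‖ₑ ^ 2 ∂arcMeasure = ∑' n : ℤ, ‖fourierCoefficient f n‖ₑ ^ 2 := by
  rw [← measurePreserving_homeomorphCircle.lintegral_comp_emb measurableEmbedding_homeomorphCircle]
  simp only [fourierCoefficient_eq]
  exact lintegral_enorm_sq_eq_tsum_fourierCoeff
    (hf.comp_measurePreserving measurePreserving_homeomorphCircle)

lemma norm_coe_zpow (ζ : Circle) (n : ℤ) : ‖(ζ : ℂ) ^ n‖ = 1 := by
  rw [norm_zpow, Circle.norm_coe, one_zpow]

@[fun_prop]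
lemma continuous_coe_circle : Continuous fun ζ : Circle => (ζ : ℂ) := continuous_subtype_val

@[fun_prop]
lemma continuous_coe_zpow (n : ℤ) : Continuous fun ζ : Circle => (ζ : ℂ) ^ n :=
  continuous_coe_circle.zpow₀ n fun ζ => Or.inl ζ.coe_ne_zero

lemma integrable_mul_zpow {f : Circle → ℂ} (hf : Integrable f arcMeasure) (n : ℤ) :
    Integrable (fun ζ : Circle => f ζ * (ζ : ℂ) ^ n) arcMeasure := by
  refine hf.mul_bdd (c := 1) (continuous_coe_zpow n).aestronglyMeasurable ?_
  exact Eventually.of_forall fun ζ => (norm_coe_zpow ζ n).le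

lemma fourierCoefficient_sub {f g : Circle → ℂ} (hf : Integrable f arcMeasure)
    (hg : Integrable g arcMeasure) (n : ℤ) :
    fourierCoefficient (fun ζ => f ζ - g ζ) n
      = fourierCoefficient f n - fourierCoefficient g n := by
  unfold fourierCoefficient
  rw [← integral_sub (integrable_mul_zpow hf _) (integrable_mul_zpow hg _)]
  simp only [sub_mul]

lemma fourierCoefficient_mul_zpow (f : Circle → ℂ) (k n : ℤ) :
    fourierCoefficient (fun ζ => f ζ * (ζ : ℂ) ^ k) n = fourierCoefficient f (n - k) := by
  unfold fourierCoefficient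
  congr 1 with ζ
  rw [mul_assoc, ← zpow_add₀ ζ.coe_ne_zero]
  congr 2; ring

lemma norm_fourierCoefficient_le (f : Circle → ℂ) (n : ℤ) :
    ‖fourierCoefficient f n‖ ≤ ∫ ζ, ‖f ζ‖ ∂arcMeasure := by
  refine (norm_integral_le_integral_norm _).trans_eq ?_
  simp only [norm_mul, norm_coe_zpow, mul_one]

lemma integral_zpow (n : ℤ) :
    ∫ ζ : Circle, (ζ : ℂ) ^ n ∂arcMeasure = if n = 0 then 1 else 0 := by
  split_ifs with hn
  · simp [hn]
  rw [integral_arcMeasure_eq _ 0]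
  have h1 : ∀ θ : ℝ, ((Circle.exp θ : Circle) : ℂ) ^ n = Complex.exp ((n * Complex.I) * θ) := by
    intro θ
    rw [Circle.coe_exp, ← Complex.exp_int_mul]
    ring_nf
  have h2 : (n : ℂ) * Complex.I ≠ 0 := by simp [hn]
  simp only [h1]
  rw [integral_exp_mul_complex h2]
  have h3 : (n : ℂ) * Complex.I * ((0 + 2 * Real.pi : ℝ) : ℂ) = n * (2 * Real.pi * Complex.I) := by
    push_cast; ring
  rw [h3, Complex.exp_int_mul_two_pi_mul_I]
  simp

lemma arcMeasure_eq_volume {S : Set Circle} (hS : MeasurableSet S) (t : ℝ) :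
    arcMeasure S = ENNReal.ofReal (2 * Real.pi)⁻¹
      * volume (Circle.exp ⁻¹' S ∩ Set.Ioc t (t + 2 * Real.pi)) := by
  have h1 := (AddCircle.measurePreserving_mk (2 * Real.pi) t).measure_preimage
    (measurePreserving_homeomorphCircle.measurable hS).nullMeasurableSet
  rw [AddCircle.volume_eq_smul_haarAddCircle, Measure.smul_apply, smul_eq_mul,
    measurePreserving_homeomorphCircle.measure_preimage hS.nullMeasurableSet] at h1
  rw [Measure.restrict_apply ((AddCircle.measurePreserving_mk (2 * Real.pi) t).measurable
    (measurePreserving_homeomorphCircle.measurable hS))] at h1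
  have h2 : (Circle.exp ⁻¹' S : Set ℝ) = QuotientAddGroup.mk ⁻¹'
    ((AddCircle.homeomorphCircle' : AddCircle (2 * Real.pi) → Circle) ⁻¹' S) := rfl
  rw [h2, h1, ← mul_assoc, ← ENNReal.ofReal_mul (by positivity),
    inv_mul_cancel₀ Real.two_pi_pos.ne', ENNReal.ofReal_one, one_mul]

lemma isOpen_arc (a b : ℝ) : IsOpen (arc a b) :=
  isLocalHomeomorph_circleExp.isOpenMap _ isOpen_Ioo

lemma arcMeasure_arc {a b : ℝ} (hb : b ≤ a + 2 * Real.pi) :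
    arcMeasure (arc a b) = ENNReal.ofReal ((b - a) / (2 * Real.pi)) := by
  rw [arcMeasure_eq_volume (isOpen_arc a b).measurableSet a]
  have h : Circle.exp ⁻¹' (arc a b) ∩ Set.Ioc a (a + 2 * Real.pi) = Set.Ioo a b := by
    ext t
    constructor
    · rintro ⟨⟨s, hs, hst⟩, ht⟩
      have := Circle.exp_injOn_Ioc (by linarith : a + 2 * Real.pi - a ≤ 2 * Real.pi)
        ⟨hs.1, hs.2.le.trans hb⟩ ht hst
      exact this ▸ hs
    · exact fun ht => ⟨⟨t, ht, rfl⟩, ht.1, ht.2.le.trans hb⟩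
  rw [h, Real.volume_Ioo, ← ENNReal.ofReal_mul (by positivity)]
  congr 1
  field_simp

instance instNullSingletonClassArcMeasure : NullSingletonClass arcMeasure where
  measure_singleton ξ := by
    rw [arcMeasure_eq_volume (measurableSet_singleton ξ) 0]
    suffices h : (Circle.exp ⁻¹' {ξ} ∩ Set.Ioc (0 : ℝ) (0 + 2 * Real.pi)).Subsingleton by
      rw [h.measure_zero, mul_zero]
    rintro s ⟨hs, hs'⟩ t ⟨ht, ht'⟩
    exact Circle.exp_injOn_Ioc (by linarith) hs' ht' (hs.trans ht.symm)

lemma isOpen_enlargedArc (γ a b : ℝ) : IsOpen (enlargedArc γ a b) := isOpen_arc _ _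

/-! ### Dilations -/

/-- The dilation `ζ ↦ F (r ζ)` of the disc extension `F` of `f`, as a function on the circle.  For
`f` with vanishing negative Fourier coefficients this is the usual dilation `f_r`; in general it
is the dilation of the Cauchy projection of `f`. -/
def dilation (r : ℝ) (f : Circle → ℂ) (ζ : Circle) : ℂ := discExtension f (r * (ζ : ℂ))

lemma summable_norm_discExtension (f : Circle → ℂ) {z : ℂ} (hz : ‖z‖ < 1) :
    Summable fun n : ℕ => ‖fourierCoefficient f n * z ^ n‖ := by
  refine Summable.of_nonneg_of_le (fun _ => norm_nonneg _) (fun n => ?_)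
    ((summable_geometric_of_lt_one (norm_nonneg z) hz).mul_left (∫ ζ, ‖f ζ‖ ∂arcMeasure))
  rw [norm_mul, norm_pow]
  gcongr
  exact norm_fourierCoefficient_le f n

lemma norm_mul_coe_lt_one {r : ℝ} (hr0 : 0 ≤ r) (hr1 : r < 1) (ζ : Circle) :
    ‖(r : ℂ) * ζ‖ < 1 := by
  simpa [abs_of_nonneg hr0, Circle.norm_coe] using hr1

lemma norm_mul_coe_mul_inv {r : ℝ} (hr0 : 0 ≤ r) (ζ η : Circle) :
    ‖(r : ℂ) * ζ * (η : ℂ)⁻¹‖ = r := by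
  simp [abs_of_nonneg hr0, Circle.norm_coe]

lemma one_sub_mul_coe_ne_zero {r : ℝ} (hr0 : 0 ≤ r) (hr1 : r < 1) (ζ η : Circle) :
    1 - (r : ℂ) * ζ * (η : ℂ)⁻¹ ≠ 0 := by
  intro h
  have := norm_mul_coe_mul_inv hr0 ζ η
  rw [← sub_eq_zero.1 h, norm_one] at this
  linarith

lemma dilation_eq_integral {r : ℝ} (hr0 : 0 ≤ r) (hr1 : r < 1) {f : Circle → ℂ}
    (hf : Integrable f arcMeasure) (ζ : Circle) :
    dilation r f ζ = ∫ η : Circle, f η * (1 - (r : ℂ) * ζ * (η : ℂ)⁻¹)⁻¹ ∂arcMeasure := by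
  have h := hasSum_integral_of_summable_integral_norm (μ := arcMeasure)
    (F := fun (n : ℕ) (η : Circle) => f η * (η : ℂ) ^ (-(n : ℤ)) * ((r : ℂ) * ζ) ^ n)
    (fun n => (integrable_mul_zpow hf _).mul_const _) (by
      simp only [norm_mul, norm_coe_zpow, mul_one, norm_pow, integral_mul_const]
      refine (summable_geometric_of_lt_one (by positivity) ?_).mul_left _
      rw [← norm_mul]; exact norm_mul_coe_lt_one hr0 hr1 ζ)
  rw [dilation, discExtension]
  simp only [integral_mul_const] at h
  refine h.tsum_eq.trans (integral_congr_ae (Eventually.of_forall fun η => ?_))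
  have h2 : ‖(r : ℂ) * ζ * (η : ℂ)⁻¹‖ < 1 := by rwa [norm_mul_coe_mul_inv hr0]
  simp only
  rw [← tsum_geometric_of_norm_lt_one h2, ← tsum_mul_left]
  congr 1 with n
  rw [mul_pow _ ((η : ℂ)⁻¹), zpow_neg, zpow_natCast, inv_pow]
  ring

lemma continuous_dilation {r : ℝ} (hr0 : 0 ≤ r) (hr1 : r < 1) (f : Circle → ℂ) :
    Continuous (dilation r f) := by
  unfold dilation discExtension
  refine continuous_tsum (u := fun n : ℕ => (∫ ζ, ‖f ζ‖ ∂arcMeasure) * r ^ n)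
    (fun n => by fun_prop) ((summable_geometric_of_lt_one hr0 hr1).mul_left _) (fun n ζ => ?_)
  have h1 : ‖(r : ℂ) * ζ‖ = r := by simp [abs_of_nonneg hr0, Circle.norm_coe]
  rw [norm_mul, norm_pow, h1]
  gcongr
  exact norm_fourierCoefficient_le f n

lemma _root_.Continuous.memLp_arcMeasure {v : Circle → ℂ} (hv : Continuous v) (p : ℝ≥0∞) :
    MemLp v p arcMeasure := by
  obtain ⟨C, hC⟩ := isCompact_univ.exists_bound_of_continuousOn hv.continuousOn
  exact MemLp.of_bound hv.aestronglyMeasurable C (Eventually.of_forall fun ζ => hC ζ trivial)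

lemma fourierCoefficient_dilation {r : ℝ} (hr0 : 0 ≤ r) (hr1 : r < 1) (f : Circle → ℂ) (n : ℤ) :
    fourierCoefficient (dilation r f) n =
      if 0 ≤ n then (r : ℂ) ^ n * fourierCoefficient f n else 0 := by
  have hi : ∀ k : ℤ, Integrable (fun ζ : Circle => (ζ : ℂ) ^ k) arcMeasure := fun k =>
    ((continuous_coe_zpow k).memLp_arcMeasure 1).integrable le_rfl
  have h := hasSum_integral_of_summable_integral_norm (μ := arcMeasure)
    (F := fun (k : ℕ) (ζ : Circle) =>
      (fourierCoefficient f k * (r : ℂ) ^ k) * (ζ : ℂ) ^ ((k : ℤ) - n))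
    (fun k => (hi _).const_mul _) (by
      simp only [norm_mul, norm_coe_zpow, mul_one, integral_const, smul_eq_mul,
        probReal_univ, one_mul, norm_pow]
      have := summable_norm_discExtension f (z := (r : ℂ)) (by simpa [abs_of_nonneg hr0] using hr1)
      simpa only [norm_mul, norm_pow] using this)
  simp only [integral_const_mul, integral_zpow] at h
  have h2 : fourierCoefficient (dilation r f) n = ∫ ζ : Circle, ∑' k : ℕ,
      (fourierCoefficient f k * (r : ℂ) ^ k) * (ζ : ℂ) ^ ((k : ℤ) - n) ∂arcMeasure := by
    refine integral_congr_ae (Eventually.of_forall fun ζ => ?_)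
    simp only [dilation, discExtension]
    rw [← tsum_mul_right]
    congr 1 with k
    rw [sub_eq_add_neg, zpow_add₀ ζ.coe_ne_zero, zpow_natCast, mul_pow]
    ring
  rw [h2, ← h.tsum_eq]
  split_ifs with hn
  · lift n to ℕ using hn
    rw [tsum_eq_single n]
    · simp [mul_comm]
    · intro k hk
      rw [if_neg (by omega), mul_zero]
  · refine (tsum_congr fun k => ?_).trans tsum_zero
    rw [if_neg (by omega), mul_zero]

lemma lintegral_dilation_le {r : ℝ} (hr0 : 0 ≤ r) (hr1 : r < 1) {f : Circle → ℂ}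
    (hf : MemLp f 2 arcMeasure) :
    ∫⁻ ζ, ‖dilation r f ζ‖ₑ ^ 2 ∂arcMeasure ≤ ∫⁻ ζ, ‖f ζ‖ₑ ^ 2 ∂arcMeasure := by
  rw [lintegral_enorm_sq_eq_tsum hf,
    lintegral_enorm_sq_eq_tsum ((continuous_dilation hr0 hr1 f).memLp_arcMeasure 2)]
  refine ENNReal.tsum_le_tsum fun n => ?_
  rw [fourierCoefficient_dilation hr0 hr1]
  gcongr
  split_ifs with hn
  · lift n to ℕ using hn
    rw [enorm_mul, zpow_natCast, enorm_pow]
    have h1 : ‖(r : ℂ)‖ₑ ≤ 1 := by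
      rw [← enorm_one (G := ℝ), enorm_le_iff_norm_le]
      simpa [abs_of_nonneg hr0] using hr1.le
    exact mul_le_of_le_one_left' (pow_le_one' h1 n)
  · simp

lemma tendsto_lintegral_dilation_sub {f : Circle → ℂ} (hf : MemLp f 2 arcMeasure)
    (hneg : ∀ n : ℤ, n < 0 → fourierCoefficient f n = 0) {r : ℕ → ℝ}
    (hr0 : ∀ k, 0 ≤ r k) (hr1 : ∀ k, r k < 1) (hr : Tendsto r atTop (𝓝 1)) :
    Tendsto (fun k => ∫⁻ ζ, ‖dilation (r k) f ζ - f ζ‖ₑ ^ 2 ∂arcMeasure) atTop (𝓝 0) := by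
  have hc : ∀ k n, fourierCoefficient (fun ζ => dilation (r k) f ζ - f ζ) n
      = ((r k : ℂ) ^ n - 1) * fourierCoefficient f n := by
    intro k n
    rw [fourierCoefficient_sub
      (((continuous_dilation (hr0 k) (hr1 k) f).memLp_arcMeasure 1).integrable le_rfl)
      (hf.integrable (by norm_num)), fourierCoefficient_dilation (hr0 k) (hr1 k)]
    split_ifs with hn
    · ring
    · rw [hneg n (by omega)]; ring
  have hP : ∀ k, ∫⁻ ζ, ‖dilation (r k) f ζ - f ζ‖ₑ ^ 2 ∂arcMeasure
      = ∫⁻ n : ℤ, ‖((r k : ℂ) ^ n - 1) * fourierCoefficient f n‖ₑ ^ 2 ∂Measure.count := by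
    intro k
    have h := lintegral_enorm_sq_eq_tsum
      (((continuous_dilation (hr0 k) (hr1 k) f).memLp_arcMeasure 2).sub hf)
    rw [lintegral_count]
    simp only [← hc]
    exact h
  simp only [hP]
  rw [← lintegral_zero (α := ℤ) (μ := Measure.count)]
  refine tendsto_lintegral_of_dominated_convergence (fun n => ‖fourierCoefficient f n‖ₑ ^ 2)
    (fun k => measurable_of_countable _) (fun k => Eventually.of_forall fun n => ?_) ?_ ?_
  · rcases lt_or_ge n 0 with hn | hn
    · simp [hneg n hn]
    · lift n to ℕ using hn
      simp only [enorm_mul]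
      refine pow_le_pow_left' (mul_le_of_le_one_left' ?_) 2
      rw [← enorm_one (G := ℝ), enorm_le_iff_norm_le, zpow_natCast]
      have h1 : ((r k : ℂ) ^ n - 1) = ((r k ^ n - 1 : ℝ) : ℂ) := by push_cast; ring
      rw [h1, Complex.norm_real, Real.norm_eq_abs, norm_one, abs_le]
      have h2 := pow_nonneg (hr0 k) n
      have h3 := pow_le_one₀ (hr0 k) (hr1 k).le (n := n)
      constructor <;> linarith
  · rw [lintegral_count, ← lintegral_enorm_sq_eq_tsum hf]
    exact ((lintegral_enorm_sq_lt_top_iff hf.1).1 hf).ne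
  · refine Eventually.of_forall fun n => ?_
    have h1 : Tendsto (fun k => (r k : ℂ) ^ n) atTop (𝓝 ((1 : ℂ) ^ n)) := by
      refine Tendsto.zpow₀ ?_ n (Or.inl one_ne_zero)
      exact (Complex.continuous_ofReal.tendsto 1).comp hr
    have h2 := (ENNReal.continuous_pow 2).tendsto _ |>.comp
      ((h1.sub_const 1).mul_const (fourierCoefficient f n)).enorm
    simpa [Function.comp_def] using h2

lemma dilation_sub {r : ℝ} (hr0 : 0 ≤ r) (hr1 : r < 1) {f g : Circle → ℂ}
    (hf : Integrable f arcMeasure) (hg : Integrable g arcMeasure) (ζ : Circle) :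
    dilation r (fun η => f η - g η) ζ = dilation r f ζ - dilation r g ζ := by
  unfold dilation discExtension
  rw [← (summable_norm_discExtension f (norm_mul_coe_lt_one hr0 hr1 ζ)).of_norm.tsum_sub
    (summable_norm_discExtension g (norm_mul_coe_lt_one hr0 hr1 ζ)).of_norm]
  simp only [fourierCoefficient_sub hf hg, sub_mul]

lemma dilation_const (r : ℝ) (c : ℂ) (ζ : Circle) : dilation r (fun _ => c) ζ = c := by
  unfold dilation discExtension
  have : ∀ n : ℕ, fourierCoefficient (fun _ => c) n = if n = 0 then c else 0 := by
    intro n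
    unfold fourierCoefficient
    rw [integral_const_mul, integral_zpow]
    by_cases hn : n = 0 <;> simp [hn]
  rw [tsum_eq_single 0]
  · rw [this, if_pos rfl, pow_zero, mul_one]
  · intro n hn
    rw [this, if_neg hn, zero_mul]

/-! ### Dilations and the local Dirichlet integral -/

/-- The difference quotient `ζ ↦ (f ζ - f ξ) / (ζ - ξ)`, whose squared `L²` norm is `𝒟_ξ(f)`. -/
def diffQuot (f : Circle → ℂ) (ξ ζ : Circle) : ℂ := (f ζ - f ξ) / ((ζ : ℂ) - (ξ : ℂ))

lemma measurable_diffQuot_uncurry {f : Circle → ℂ} (hf : Measurable f) :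
    Measurable fun p : Circle × Circle => diffQuot f p.1 p.2 := by
  have := continuous_coe_circle.measurable
  unfold diffQuot
  fun_prop

lemma measurable_diffQuot {f : Circle → ℂ} (hf : Measurable f) (ξ : Circle) :
    Measurable (diffQuot f ξ) :=
  (measurable_diffQuot_uncurry hf).comp measurable_prodMk_left

lemma measurable_localDirichlet {f : Circle → ℂ} (hf : Measurable f) :
    Measurable (localDirichlet f) :=
  ((measurable_diffQuot_uncurry hf).enorm.pow_const 2).lintegral_prod_right'

lemma memLp_diffQuot {f : Circle → ℂ} (hf : Measurable f) {ξ : Circle}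
    (hξ : localDirichlet f ξ < ∞) : MemLp (diffQuot f ξ) 2 arcMeasure :=
  (lintegral_enorm_sq_lt_top_iff (measurable_diffQuot hf ξ).aestronglyMeasurable).2 hξ

lemma diffQuot_mul_sub (f : Circle → ℂ) (ξ η : Circle) :
    diffQuot f ξ η * ((η : ℂ) - ξ) = f η - f ξ := by
  by_cases h : η = ξ
  · simp [h]
  · exact div_mul_cancel₀ _ (sub_ne_zero.2 fun h' => h (Circle.coe_injective h'))

/-- The multiplier `w_r(η) = (1 - ξ η̄) / (1 - r ξ η̄)`. -/
def dilationWeight (r : ℝ) (ξ η : Circle) : ℂ :=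
  (1 - (ξ : ℂ) * (η : ℂ)⁻¹) * (1 - (r : ℂ) * ξ * (η : ℂ)⁻¹)⁻¹

lemma norm_dilationWeight_le {r : ℝ} (hr0 : 0 ≤ r) (hr1 : r < 1) (ξ η : Circle) :
    ‖dilationWeight r ξ η‖ ≤ 2 := by
  have h0 := one_sub_mul_coe_ne_zero hr0 hr1 ξ η
  rw [dilationWeight, ← div_eq_mul_inv, norm_div, div_le_iff₀ (norm_pos_iff.2 h0)]
  have hx : ‖(ξ : ℂ) * (η : ℂ)⁻¹‖ = 1 := by simp [Circle.norm_coe]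
  have h1 : (1 - (ξ : ℂ) * (η : ℂ)⁻¹) = (1 - (r : ℂ) * ξ * (η : ℂ)⁻¹)
      - ((1 - r : ℝ) : ℂ) * ((ξ : ℂ) * (η : ℂ)⁻¹) := by push_cast; ring
  have h2 : 1 - r ≤ ‖1 - (r : ℂ) * ξ * (η : ℂ)⁻¹‖ := by
    have := norm_sub_norm_le (1 : ℂ) ((r : ℂ) * ξ * (η : ℂ)⁻¹)
    rwa [norm_one, norm_mul_coe_mul_inv hr0] at this
  have h3 := norm_sub_le (1 - (r : ℂ) * ξ * (η : ℂ)⁻¹) (((1 - r : ℝ) : ℂ) * ((ξ : ℂ) * (η : ℂ)⁻¹))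
  rw [← h1, norm_mul, hx, Complex.norm_real, Real.norm_eq_abs, abs_of_nonneg (by linarith)] at h3
  linarith

lemma continuous_dilationWeight {r : ℝ} (hr0 : 0 ≤ r) (hr1 : r < 1) (ξ : Circle) :
    Continuous (dilationWeight r ξ) := by
  have h1 : Continuous fun η : Circle => (η : ℂ)⁻¹ :=
    continuous_coe_circle.inv₀ fun η => η.coe_ne_zero
  unfold dilationWeight
  refine (continuous_const.sub (continuous_const.mul h1)).mul
    ((continuous_const.sub (continuous_const.mul h1)).inv₀ fun η => ?_)
  exact one_sub_mul_coe_ne_zero hr0 hr1 ξ η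

lemma tendsto_dilationWeight {r : ℕ → ℝ} (hr : Tendsto r atTop (𝓝 1)) {ξ η : Circle}
    (h : η ≠ ξ) : Tendsto (fun k => dilationWeight (r k) ξ η) atTop (𝓝 1) := by
  have h0 : 1 - (ξ : ℂ) * (η : ℂ)⁻¹ ≠ 0 := by
    rw [sub_ne_zero, ← div_eq_mul_inv, ne_comm, Ne, div_eq_one_iff_eq η.coe_ne_zero]
    exact fun h' => h (Circle.coe_injective h'.symm)
  have h1 : Tendsto (fun k => (r k : ℂ)) atTop (𝓝 1) := by
    simpa [Function.comp_def] using (Complex.continuous_ofReal.tendsto 1).comp hr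
  have h2 : Tendsto (fun k => 1 - (r k : ℂ) * ξ * (η : ℂ)⁻¹) atTop
      (𝓝 (1 - (ξ : ℂ) * (η : ℂ)⁻¹)) := by
    simpa using ((h1.mul_const (ξ : ℂ)).mul_const ((η : ℂ)⁻¹)).const_sub 1
  have h3 := (h2.inv₀ h0).const_mul (1 - (ξ : ℂ) * (η : ℂ)⁻¹)
  rwa [mul_inv_cancel₀ h0] at h3

lemma memLp_mul_dilationWeight {r : ℝ} (hr0 : 0 ≤ r) (hr1 : r < 1) (ξ : Circle) {g : Circle → ℂ}
    {p : ℝ≥0∞} (hg : MemLp g p arcMeasure) :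
    MemLp (fun η => g η * dilationWeight r ξ η) p arcMeasure := by
  refine (hg.const_mul (2 : ℂ)).of_le
    (hg.1.mul (continuous_dilationWeight hr0 hr1 ξ).aestronglyMeasurable)
    (Eventually.of_forall fun η => ?_)
  rw [norm_mul, norm_mul, mul_comm]
  gcongr
  simpa using norm_dilationWeight_le hr0 hr1 ξ η

/-- The difference quotient of a dilation is the dilation of the difference quotient multiplied by
the bounded weight `w_r`: inserting the Cauchy kernel,
`1 / (1 - r ζ η̄) - 1 / (1 - r ξ η̄) = r (ζ - ξ) η̄ / ((1 - r ζ η̄) (1 - r ξ η̄))`, and the factor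
`η - ξ` that `f η - f ξ` contributes combines with `η̄ / (1 - r ξ η̄)` to `w_r(η)`. -/
lemma diffQuot_dilation {r : ℝ} (hr0 : 0 ≤ r) (hr1 : r < 1) {f : Circle → ℂ}
    (hf : Integrable f arcMeasure) {ξ : Circle} (hg : Integrable (diffQuot f ξ) arcMeasure)
    {ζ : Circle} (hζ : ζ ≠ ξ) :
    diffQuot (dilation r f) ξ ζ
      = r * dilation r (fun η => diffQuot f ξ η * dilationWeight r ξ η) ζ := by
  have hfc : Integrable (fun η => f η - f ξ) arcMeasure := hf.sub (integrable_const _)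
  have h1 : ∀ ζ' : Circle, dilation r f ζ' = dilation r (fun η => f η - f ξ) ζ' + f ξ := by
    intro ζ'
    rw [dilation_sub hr0 hr1 hf (integrable_const _), dilation_const]; ring
  have hgw : Integrable (fun η => diffQuot f ξ η * dilationWeight r ξ η) arcMeasure :=
    memLp_one_iff_integrable.1
      (memLp_mul_dilationWeight hr0 hr1 ξ (memLp_one_iff_integrable.2 hg))
  have hk : ∀ (ζ' : Circle) {h : Circle → ℂ}, Integrable h arcMeasure →
      Integrable (fun η : Circle => h η * (1 - (r : ℂ) * ζ' * (η : ℂ)⁻¹)⁻¹) arcMeasure := by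
    intro ζ' h hh
    have hc : Continuous fun η : Circle => (1 - (r : ℂ) * ζ' * (η : ℂ)⁻¹)⁻¹ := by
      have h1 : Continuous fun η : Circle => (η : ℂ)⁻¹ :=
        continuous_coe_circle.inv₀ fun η => η.coe_ne_zero
      exact (continuous_const.sub (continuous_const.mul h1)).inv₀
        fun η => one_sub_mul_coe_ne_zero hr0 hr1 ζ' η
    obtain ⟨C, hC⟩ := isCompact_univ.exists_bound_of_continuousOn hc.continuousOn
    exact hh.mul_bdd (c := C) hc.aestronglyMeasurable (Eventually.of_forall fun η => hC η trivial)
  have hne : (ζ : ℂ) - ξ ≠ 0 := sub_ne_zero.2 fun h' => hζ (Circle.coe_injective h')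
  rw [diffQuot, h1 ζ, h1 ξ, div_eq_iff hne, dilation_eq_integral hr0 hr1 hfc,
    dilation_eq_integral hr0 hr1 hfc, dilation_eq_integral hr0 hr1 hgw, add_sub_add_right_eq_sub,
    ← integral_sub (hk ζ hfc) (hk ξ hfc), mul_right_comm, ← integral_const_mul]
  refine integral_congr_ae (Eventually.of_forall fun η => ?_)
  have e1 := one_sub_mul_coe_ne_zero hr0 hr1 ζ η
  have e2 := one_sub_mul_coe_ne_zero hr0 hr1 ξ η
  have e3 := η.coe_ne_zero
  simp only [← diffQuot_mul_sub f ξ η, dilationWeight]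
  generalize diffQuot f ξ η = g
  have e4 : (1 - (ξ : ℂ) * (η : ℂ)⁻¹) = (η - ξ) * (η : ℂ)⁻¹ := by
    rw [sub_mul, mul_inv_cancel₀ e3]
  have e5 : (1 - (r : ℂ) * ζ * (η : ℂ)⁻¹)⁻¹ - (1 - (r : ℂ) * ξ * (η : ℂ)⁻¹)⁻¹
      = r * (ζ - ξ) * (η : ℂ)⁻¹ * (1 - (r : ℂ) * ξ * (η : ℂ)⁻¹)⁻¹ *
        (1 - (r : ℂ) * ζ * (η : ℂ)⁻¹)⁻¹ := by
    rw [inv_sub_inv e1 e2, div_eq_mul_inv, mul_inv]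
    ring
  rw [← mul_sub, e5, e4]
  ring

lemma ae_ne_arcMeasure (ξ : Circle) : ∀ᵐ ζ ∂arcMeasure, ζ ≠ ξ := by
  rw [ae_iff]
  simp

lemma enorm_add_sq_le {E : Type*} [NormedAddCommGroup E] (a b : E) :
    ‖a + b‖ₑ ^ 2 ≤ 2 * ‖a‖ₑ ^ 2 + 2 * ‖b‖ₑ ^ 2 := by
  have h := pow_le_pow_left' (enorm_add_le a b) 2
  refine h.trans ?_
  have := ENNReal.rpow_add_le_mul_rpow_add_rpow ‖a‖ₑ ‖b‖ₑ (p := 2) (by norm_num)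
  norm_num at this
  rw [← mul_add]
  exact this

lemma localDirichlet_sub_le (u : Circle → ℂ) {v : Circle → ℂ} (hv : Measurable v) (ξ : Circle) :
    localDirichlet (fun ζ => u ζ - v ζ) ξ ≤ 2 * localDirichlet u ξ + 2 * localDirichlet v ξ := by
  change ∫⁻ ζ, ‖diffQuot (fun ζ => u ζ - v ζ) ξ ζ‖ₑ ^ 2 ∂arcMeasure
    ≤ 2 * (∫⁻ ζ, ‖diffQuot u ξ ζ‖ₑ ^ 2 ∂arcMeasure)
      + 2 * ∫⁻ ζ, ‖diffQuot v ξ ζ‖ₑ ^ 2 ∂arcMeasure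
  rw [← lintegral_const_mul' _ _ (by norm_num), ← lintegral_const_mul' _ _ (by norm_num),
    ← lintegral_add_right _ (((measurable_diffQuot hv ξ).enorm.pow_const 2).const_mul 2)]
  refine lintegral_mono fun ζ => ?_
  have h1 : diffQuot (fun ζ => u ζ - v ζ) ξ ζ = diffQuot u ξ ζ + -diffQuot v ξ ζ := by
    simp only [diffQuot]; ring
  rw [h1, ← enorm_neg (diffQuot v ξ ζ)]
  exact enorm_add_sq_le _ _

lemma localDirichlet_dilation_le {r : ℝ} (hr0 : 0 ≤ r) (hr1 : r < 1) {f : Circle → ℂ}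
    (hf : Measurable f) (hf2 : MemLp f 2 arcMeasure) (ξ : Circle) :
    localDirichlet (dilation r f) ξ ≤ 4 * localDirichlet f ξ := by
  by_cases hξ : localDirichlet f ξ < ∞
  swap
  · rw [not_lt, top_le_iff] at hξ
    rw [hξ, ENNReal.mul_top (by norm_num)]
    exact le_top
  have hg := memLp_diffQuot hf hξ
  have h1 : localDirichlet (dilation r f) ξ ≤ ∫⁻ ζ,
      ‖dilation r (fun η => diffQuot f ξ η * dilationWeight r ξ η) ζ‖ₑ ^ 2 ∂arcMeasure := by
    refine lintegral_mono_ae ?_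
    filter_upwards [ae_ne_arcMeasure ξ] with ζ hζ
    have h2 := diffQuot_dilation hr0 hr1 (hf2.integrable (by norm_num))
      (hg.integrable (by norm_num)) hζ
    rw [diffQuot] at h2
    rw [h2, enorm_mul]
    refine pow_le_pow_left' (mul_le_of_le_one_left' ?_) 2
    rw [← enorm_one (G := ℝ), enorm_le_iff_norm_le]
    simpa [abs_of_nonneg hr0] using hr1.le
  refine h1.trans ((lintegral_dilation_le hr0 hr1
    (memLp_mul_dilationWeight hr0 hr1 ξ hg)).trans ?_)
  rw [localDirichlet, ← lintegral_const_mul' _ _ (by norm_num)]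
  refine lintegral_mono fun η => ?_
  rw [enorm_mul, mul_pow, mul_comm]
  refine mul_le_mul' ?_ le_rfl
  have h3 : ‖dilationWeight r ξ η‖ₑ ≤ 2 := by
    rw [← ofReal_norm]
    exact ENNReal.ofReal_le_of_le_toReal (by simpa using norm_dilationWeight_le hr0 hr1 ξ η)
  exact (pow_le_pow_left' h3 2).trans (by norm_num)

/-- If `f` is analytic and `𝒟_ξ(f) < ∞`, then `(f - f ξ) / (ζ - ξ)` is analytic: by
`f - f ξ = (ζ - ξ) g` all coefficients `ĝ(n)`, `n < 0`, have the same modulus, and they are square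
summable. -/
lemma fourierCoefficient_diffQuot_of_neg {f : Circle → ℂ} (hf : Measurable f)
    (hf2 : MemLp f 2 arcMeasure) (hneg : ∀ n : ℤ, n < 0 → fourierCoefficient f n = 0)
    {ξ : Circle} (hξ : localDirichlet f ξ < ∞) {n : ℤ} (hn : n < 0) :
    fourierCoefficient (diffQuot f ξ) n = 0 := by
  have hg := memLp_diffQuot hf hξ
  have hgi : Integrable (diffQuot f ξ) arcMeasure := hg.integrable (by norm_num)
  set g := diffQuot f ξ with hgdef
  have hrec : ∀ n : ℤ, n < 0 → fourierCoefficient g (n - 1) = ξ * fourierCoefficient g n := by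
    intro n hn
    have h1 : fourierCoefficient (fun η => f η - f ξ) n = 0 := by
      rw [fourierCoefficient_sub (hf2.integrable (by norm_num)) (integrable_const _), hneg n hn]
      unfold fourierCoefficient
      rw [integral_const_mul, integral_zpow, if_neg (by omega)]
      simp
    have h2 : fourierCoefficient (fun η => g η * (η : ℂ) ^ (1 : ℤ) - ξ * g η) n = 0 := by
      rw [← h1]
      congr 1 with η
      rw [← diffQuot_mul_sub, zpow_one, hgdef]; ring
    rw [fourierCoefficient_sub (integrable_mul_zpow hgi 1) (hgi.const_mul _),
      fourierCoefficient_mul_zpow, sub_eq_zero] at h2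
    rw [h2]
    unfold fourierCoefficient
    rw [← integral_const_mul]
    simp only [mul_assoc]
  have hnorm : ∀ k : ℕ, ‖fourierCoefficient g (n - k)‖ₑ = ‖fourierCoefficient g n‖ₑ := by
    intro k
    induction k with
    | zero => simp
    | succ k ih =>
      rw [← ih]
      have := hrec (n - k) (by omega)
      rw [show n - ((k + 1 : ℕ) : ℤ) = n - k - 1 by push_cast; ring, this, enorm_mul]
      have h1 : ‖(ξ : ℂ)‖ₑ = 1 := by
        rw [← ofReal_norm, Circle.norm_coe, ENNReal.ofReal_one]
      rw [h1, one_mul]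
  by_contra hne
  have htop : ∑' k : ℕ, ‖fourierCoefficient g (n - k)‖ₑ ^ 2 ≠ ∞ := by
    refine ((ENNReal.tsum_comp_le_tsum_of_injective (f := fun k : ℕ => n - (k : ℤ))
      (fun a b h => by simpa using h) fun n => ‖fourierCoefficient g n‖ₑ ^ 2).trans_lt ?_).ne
    rw [← lintegral_enorm_sq_eq_tsum hg]
    exact hξ
  simp only [hnorm] at htop
  exact htop (ENNReal.tsum_const_eq_top_of_ne_zero (by simpa using hne))

lemma tendsto_localDirichlet_dilation_sub {f : Circle → ℂ} (hf : Measurable f)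
    (hf2 : MemLp f 2 arcMeasure) (hneg : ∀ n : ℤ, n < 0 → fourierCoefficient f n = 0)
    {r : ℕ → ℝ} (hr0 : ∀ k, 0 ≤ r k) (hr1 : ∀ k, r k < 1) (hr : Tendsto r atTop (𝓝 1))
    {ξ : Circle} (hξ : localDirichlet f ξ < ∞) :
    Tendsto (fun k => localDirichlet (fun ζ => dilation (r k) f ζ - f ζ) ξ) atTop (𝓝 0) := by
  have hg := memLp_diffQuot hf hξ
  have hgi : Integrable (diffQuot f ξ) arcMeasure := hg.integrable (by norm_num)
  have hgm := measurable_diffQuot hf ξ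
  have hG : ∫⁻ η, ‖diffQuot f ξ η‖ₑ ^ 2 ∂arcMeasure < ∞ := hξ
  have hrc : Tendsto (fun k => (r k : ℂ)) atTop (𝓝 1) := by
    simpa [Function.comp_def] using (Complex.continuous_ofReal.tendsto 1).comp hr
  set g := diffQuot f ξ with hgdef
  have hA : Tendsto (fun k => ∫⁻ η, ‖g η * dilationWeight (r k) ξ η - g η‖ₑ ^ 2 ∂arcMeasure)
      atTop (𝓝 0) := by
    rw [← lintegral_zero (α := Circle) (μ := arcMeasure)]
    refine tendsto_lintegral_of_dominated_convergence (fun η => 9 * ‖g η‖ₑ ^ 2)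
      (fun k => ?_) (fun k => Eventually.of_forall fun η => ?_) ?_ ?_
    · have := (continuous_dilationWeight (hr0 k) (hr1 k) ξ).measurable
      fun_prop
    · have h1 : ‖g η * dilationWeight (r k) ξ η - g η‖ₑ ≤ 3 * ‖g η‖ₑ := by
        rw [← mul_sub_one, enorm_mul, mul_comm]
        refine mul_le_mul' ?_ le_rfl
        rw [← ofReal_norm]
        refine ENNReal.ofReal_le_of_le_toReal ?_
        have := norm_dilationWeight_le (hr0 k) (hr1 k) ξ η
        have h2 := norm_sub_le (dilationWeight (r k) ξ η) 1
        rw [norm_one] at h2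
        simpa using by linarith
      refine (pow_le_pow_left' h1 2).trans_eq ?_
      rw [mul_pow]; norm_num
    · rw [lintegral_const_mul' _ _ (by norm_num)]
      exact ENNReal.mul_ne_top (by norm_num) hG.ne
    · filter_upwards [ae_ne_arcMeasure ξ] with η hη
      have h2 := (ENNReal.continuous_pow 2).tendsto _ |>.comp
        (((tendsto_dilationWeight hr hη).const_mul (g η)).sub_const (g η)).enorm
      simpa [Function.comp_def] using h2
  have hB := tendsto_lintegral_dilation_sub hg
    (fun n hn => fourierCoefficient_diffQuot_of_neg hf hf2 hneg hξ hn) hr0 hr1 hr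
  have hC : Tendsto (fun k => ‖(r k : ℂ) - 1‖ₑ ^ 2 * ∫⁻ η, ‖g η‖ₑ ^ 2 ∂arcMeasure)
      atTop (𝓝 0) := by
    have h1 := (ENNReal.continuous_pow 2).tendsto _ |>.comp (hrc.sub_const 1).enorm
    have h2 := ENNReal.Tendsto.mul_const (b := ∫⁻ η, ‖g η‖ₑ ^ 2 ∂arcMeasure) h1 (Or.inr hG.ne)
    simpa [Function.comp_def] using h2
  have hsum : Tendsto (fun k =>
      2 * (∫⁻ η, ‖g η * dilationWeight (r k) ξ η - g η‖ₑ ^ 2 ∂arcMeasure)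
      + (4 * (∫⁻ ζ, ‖dilation (r k) g ζ - g ζ‖ₑ ^ 2 ∂arcMeasure)
      + 4 * (‖(r k : ℂ) - 1‖ₑ ^ 2 * ∫⁻ η, ‖g η‖ₑ ^ 2 ∂arcMeasure))) atTop (𝓝 0) := by
    have h1 := ENNReal.Tendsto.const_mul (a := 2) hA (Or.inr (by norm_num))
    have h2 := ENNReal.Tendsto.const_mul (a := 4) hB (Or.inr (by norm_num))
    have h3 := ENNReal.Tendsto.const_mul (a := 4) hC (Or.inr (by norm_num))
    simpa using h1.add (h2.add h3)
  refine tendsto_of_tendsto_of_tendsto_of_le_of_le tendsto_const_nhds hsum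
    (fun _ => zero_le) fun k => ?_
  have hgw := memLp_mul_dilationWeight (hr0 k) (hr1 k) ξ hg
  have hgwi : Integrable (fun η => g η * dilationWeight (r k) ξ η) arcMeasure :=
    hgw.integrable (by norm_num)
  have hdm : Measurable (dilation (r k) (fun η => g η * dilationWeight (r k) ξ η - g η)) :=
    (continuous_dilation (hr0 k) (hr1 k) _).measurable
  have hdm' : Measurable (dilation (r k) g) := (continuous_dilation (hr0 k) (hr1 k) _).measurable
  have hr_le : ‖(r k : ℂ)‖ₑ ≤ 1 := by
    rw [← enorm_one (G := ℝ), enorm_le_iff_norm_le]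
    simpa [abs_of_nonneg (hr0 k)] using (hr1 k).le
  calc localDirichlet (fun ζ => dilation (r k) f ζ - f ζ) ξ
      ≤ ∫⁻ ζ, (2 * ‖dilation (r k) (fun η => g η * dilationWeight (r k) ξ η - g η) ζ‖ₑ ^ 2
        + (4 * ‖dilation (r k) g ζ - g ζ‖ₑ ^ 2 + 4 * (‖(r k : ℂ) - 1‖ₑ ^ 2 * ‖g ζ‖ₑ ^ 2)))
          ∂arcMeasure := by
        refine lintegral_mono_ae ?_
        filter_upwards [ae_ne_arcMeasure ξ] with ζ hζ
        have h2 := diffQuot_dilation (hr0 k) (hr1 k) (hf2.integrable (by norm_num)) hgi hζ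
        have h3 : (dilation (r k) f ζ - f ζ - (dilation (r k) f ξ - f ξ)) / ((ζ : ℂ) - ξ)
            = r k * dilation (r k) (fun η => g η * dilationWeight (r k) ξ η - g η) ζ
              + (r k * (dilation (r k) g ζ - g ζ) + (r k - 1) * g ζ) := by
          rw [dilation_sub (hr0 k) (hr1 k) hgwi hgi]
          have h4 : (dilation (r k) f ζ - f ζ - (dilation (r k) f ξ - f ξ)) / ((ζ : ℂ) - ξ)
              = diffQuot (dilation (r k) f) ξ ζ - g ζ := by
            simp only [hgdef, diffQuot]; ring
          rw [h4, h2]; ring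
        rw [h3]
        refine (enorm_add_sq_le _ _).trans (add_le_add ?_ ?_)
        · gcongr
          rw [enorm_mul]
          exact mul_le_of_le_one_left' hr_le
        · refine (mul_le_mul' le_rfl (enorm_add_sq_le _ _)).trans ?_
          rw [mul_add, ← mul_assoc, ← mul_assoc]
          norm_num
          refine add_le_add ?_ ?_
          · gcongr
            exact mul_le_of_le_one_left' hr_le
          · rw [mul_pow]
    _ = 2 * (∫⁻ ζ, ‖dilation (r k) (fun η => g η * dilationWeight (r k) ξ η - g η) ζ‖ₑ ^ 2
          ∂arcMeasure)
        + (4 * (∫⁻ ζ, ‖dilation (r k) g ζ - g ζ‖ₑ ^ 2 ∂arcMeasure)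
        + 4 * (‖(r k : ℂ) - 1‖ₑ ^ 2 * ∫⁻ η, ‖g η‖ₑ ^ 2 ∂arcMeasure)) := by
        rw [lintegral_add_left (by fun_prop), lintegral_add_left (by fun_prop),
          lintegral_const_mul' _ _ (by norm_num), lintegral_const_mul' _ _ (by norm_num),
          lintegral_const_mul' _ _ (by norm_num), lintegral_const_mul' _ _ (by finiteness)]
    _ ≤ _ := by
        refine add_le_add (mul_le_mul' le_rfl ?_) le_rfl
        exact lintegral_dilation_le (hr0 k) (hr1 k) (hgw.sub hg)

lemma tendsto_normSq_dilation_sub (μ : Measure Circle) {f : Circle → ℂ}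
    (hf : f ∈ analyticSpace μ) {r : ℕ → ℝ} (hr0 : ∀ k, 0 ≤ r k) (hr1 : ∀ k, r k < 1)
    (hr : Tendsto r atTop (𝓝 1)) :
    Tendsto (fun k => normSq μ (fun ζ => dilation (r k) f ζ - f ζ)) atTop (𝓝 0) := by
  obtain ⟨⟨hfm, hf2, hfD⟩, hneg⟩ := hf
  have h1 := tendsto_lintegral_dilation_sub hf2 hneg hr0 hr1 hr
  have hdm : ∀ k, Measurable (fun ζ => dilation (r k) f ζ - f ζ) := fun k =>
    (continuous_dilation (hr0 k) (hr1 k) _).measurable.sub hfm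
  have h2 : Tendsto (fun k => dirichletIntegral μ (fun ζ => dilation (r k) f ζ - f ζ))
      atTop (𝓝 0) := by
    unfold dirichletIntegral
    rw [← lintegral_zero (α := Circle) (μ := μ)]
    refine tendsto_lintegral_of_dominated_convergence (fun ξ => 10 * localDirichlet f ξ)
      (fun k => measurable_localDirichlet (hdm k)) (fun k => Eventually.of_forall fun ξ => ?_) ?_ ?_
    · have h3 : localDirichlet (fun ζ => dilation (r k) f ζ - f ζ) ξ
          ≤ 2 * localDirichlet (dilation (r k) f) ξ + 2 * localDirichlet f ξ :=
        localDirichlet_sub_le _ hfm ξ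
      refine h3.trans ((add_le_add_left (mul_le_mul' le_rfl
        (localDirichlet_dilation_le (hr0 k) (hr1 k) hfm hf2 ξ)) _).trans_eq ?_)
      rw [← mul_assoc, ← add_mul]
      norm_num
    · rw [lintegral_const_mul' _ _ (by norm_num)]
      exact ENNReal.mul_ne_top (by norm_num) hfD.ne
    · filter_upwards [ae_lt_top (measurable_localDirichlet hfm) hfD.ne] with ξ hξ
      exact tendsto_localDirichlet_dilation_sub hfm hf2 hneg hr0 hr1 hr hξ
  simpa [normSq] using h1.add h2

/-! ### The capacity -/

section capacity

variable {μ : Measure Circle}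

lemma localDirichlet_le_of_norm_sub_le {u v : Circle → ℂ} {ξ : Circle}
    (h : ∀ ζ, ‖u ζ - u ξ‖ ≤ ‖v ζ - v ξ‖) : localDirichlet u ξ ≤ localDirichlet v ξ := by
  refine lintegral_mono fun ζ => ?_
  refine pow_le_pow_left' ?_ 2
  rw [enorm_le_iff_norm_le, norm_div, norm_div]
  gcongr
  exact h ζ

lemma normSq_le_of_contraction {u v : Circle → ℂ} (h1 : ∀ ζ, ‖u ζ‖ ≤ ‖v ζ‖)
    (h2 : ∀ ζ ξ, ‖u ζ - u ξ‖ ≤ ‖v ζ - v ξ‖) : normSq μ u ≤ normSq μ v := by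
  refine add_le_add (lintegral_mono fun ζ => pow_le_pow_left' ?_ 2)
    (lintegral_mono fun ξ => localDirichlet_le_of_norm_sub_le fun ζ => h2 ζ ξ)
  rw [enorm_le_iff_norm_le]
  exact h1 ζ

lemma normSq_const_mul (c : ℂ) (v : Circle → ℂ) :
    normSq μ (fun ζ => c * v ζ) = ‖c‖ₑ ^ 2 * normSq μ v := by
  have hc : ‖c‖ₑ ^ 2 ≠ ∞ := by finiteness
  have h1 : ∀ ξ, localDirichlet (fun ζ => c * v ζ) ξ = ‖c‖ₑ ^ 2 * localDirichlet v ξ := by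
    intro ξ
    unfold localDirichlet
    rw [← lintegral_const_mul' _ _ hc]
    refine lintegral_congr fun ζ => ?_
    rw [← mul_sub, mul_div_assoc, enorm_mul, mul_pow]
  unfold normSq dirichletIntegral
  simp only [h1]
  simp only [enorm_mul, mul_pow]
  rw [lintegral_const_mul' _ _ hc, lintegral_const_mul' _ _ hc, mul_add]

lemma mem_harmonicSpace_of_normSq_lt_top {f : Circle → ℂ} (hf : Measurable f)
    (h : normSq μ f < ∞) : f ∈ harmonicSpace μ := by
  rw [normSq, ENNReal.add_lt_top] at h
  exact ⟨hf, (lintegral_enorm_sq_lt_top_iff hf.aestronglyMeasurable).2 h.1, h.2⟩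

lemma normSq_lt_top_of_mem {f : Circle → ℂ} (hf : f ∈ harmonicSpace μ) : normSq μ f < ∞ :=
  ENNReal.add_lt_top.2 ⟨(lintegral_enorm_sq_lt_top_iff hf.2.1.1).1 hf.2.1, hf.2.2⟩

lemma capacity_le_normSq {A U : Set Circle} (hU : IsOpen U) (hA : A ⊆ U) {f : Circle → ℂ}
    (hf : Measurable f) (h : ∀ᵐ ζ ∂arcMeasure, ζ ∈ U → 1 ≤ ‖f ζ‖) :
    capacity μ A ≤ normSq μ f := by
  by_cases ht : normSq μ f < ∞
  · exact sInf_le ⟨f, mem_harmonicSpace_of_normSq_lt_top hf ht, ⟨U, hU, hA, h⟩, rfl⟩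
  · rw [not_lt, top_le_iff] at ht
    exact ht ▸ le_top

lemma capacity_mono {A B : Set Circle} (h : A ⊆ B) : capacity μ A ≤ capacity μ B := by
  refine sInf_le_sInf ?_
  rintro c ⟨f, hf, ⟨U, hU, hBU, hfU⟩, rfl⟩
  exact ⟨f, hf, ⟨U, hU, h.trans hBU, hfU⟩, rfl⟩

lemma capacity_le_one (A : Set Circle) : capacity μ A ≤ 1 := by
  refine (capacity_le_normSq isOpen_univ (Set.subset_univ A) (f := fun _ => 1)
    measurable_const (by simp)).trans_eq ?_
  simp [normSq, dirichletIntegral, localDirichlet]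

/-- Test functions for the capacity may be taken with values in `[0, 1]`, since truncation is a
contraction. -/
lemma exists_test_of_capacity_lt {A : Set Circle} {c : ℝ≥0∞} (h : capacity μ A < c) :
    ∃ u : Circle → ℝ, Measurable u ∧ (∀ ζ, 0 ≤ u ζ) ∧ (∀ ζ, u ζ ≤ 1) ∧
      (∃ U : Set Circle, IsOpen U ∧ A ⊆ U ∧ ∀ᵐ ζ ∂arcMeasure, ζ ∈ U → 1 ≤ u ζ) ∧
      normSq μ (fun ζ => (u ζ : ℂ)) < c := by
  obtain ⟨_, ⟨f, hf, ⟨U, hU, hAU, hfU⟩, rfl⟩, hc⟩ := sInf_lt_iff.1 h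
  refine ⟨fun ζ => min ‖f ζ‖ 1, hf.1.norm.min measurable_const,
    fun ζ => le_min (norm_nonneg _) zero_le_one, fun ζ => min_le_right _ _,
    ⟨U, hU, hAU, ?_⟩, (normSq_le_of_contraction (fun ζ => ?_) fun ζ ξ => ?_).trans_lt hc⟩
  · filter_upwards [hfU] with ζ hζ hU
    exact le_min (hζ hU) le_rfl
  · rw [Complex.norm_real, Real.norm_eq_abs, abs_of_nonneg (le_min (norm_nonneg _) zero_le_one)]
    exact min_le_left _ _
  · rw [← Complex.ofReal_sub, Complex.norm_real, Real.norm_eq_abs]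
    refine (abs_min_sub_min_le_max _ _ _ _).trans ?_
    rw [sub_self, abs_zero, max_eq_left (abs_nonneg _)]
    exact abs_norm_sub_norm_le _ _

lemma enorm_iSup_sub_iSup_sq_le {a b : ℕ → ℝ} (ha : BddAbove (Set.range a))
    (hb : BddAbove (Set.range b)) :
    ‖(⨆ k, a k) - ⨆ k, b k‖ₑ ^ 2 ≤ ∑' k, ‖a k - b k‖ₑ ^ 2 := by
  by_cases hT : ∑' k, ‖a k - b k‖ₑ ^ 2 = ∞
  · rw [hT]; exact le_top
  set T := ∑' k, ‖a k - b k‖ₑ ^ 2 with hTdef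
  have hk : ∀ k, |a k - b k| ≤ √T.toReal := by
    intro k
    refine Real.le_sqrt_of_sq_le ?_
    rw [← ENNReal.ofReal_le_iff_le_toReal hT, ENNReal.ofReal_pow (abs_nonneg _),
      ← Real.norm_eq_abs, ofReal_norm]
    exact ENNReal.le_tsum k
  have h1 : ⨆ k, a k ≤ (⨆ k, b k) + √T.toReal := ciSup_le fun k => by
    have := le_ciSup hb k
    have := (abs_le.1 (hk k)).2
    linarith
  have h2 : ⨆ k, b k ≤ (⨆ k, a k) + √T.toReal := ciSup_le fun k => by
    have := le_ciSup ha k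
    have := (abs_le.1 (hk k)).1
    linarith
  rw [← ofReal_norm, ← ENNReal.ofReal_pow (norm_nonneg _), ENNReal.ofReal_le_iff_le_toReal hT,
    Real.norm_eq_abs, sq_abs, ← Real.sq_sqrt ENNReal.toReal_nonneg]
  exact sq_le_sq' (by linarith) (by linarith)

/-- The energy of a supremum is at most the sum of the energies. -/
lemma normSq_iSup_le {u : ℕ → Circle → ℝ} (hu : ∀ k, Measurable (u k))
    (h1 : ∀ k ζ, u k ζ ≤ 1) :
    normSq μ (fun ζ => ((⨆ k, u k ζ : ℝ) : ℂ)) ≤ ∑' k, normSq μ (fun ζ => (u k ζ : ℂ)) := by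
  have hb : ∀ ζ, BddAbove (Set.range fun k => u k ζ) := fun ζ =>
    ⟨1, by rintro _ ⟨k, rfl⟩; exact h1 k ζ⟩
  have hz : BddAbove (Set.range fun _ : ℕ => (0 : ℝ)) := ⟨0, by rintro _ ⟨k, rfl⟩; exact le_rfl⟩
  have hum : ∀ k, Measurable fun ζ => (u k ζ : ℂ) := fun k => Complex.measurable_ofReal.comp (hu k)
  have hoe : ∀ x : ℝ, ‖(x : ℂ)‖ₑ = ‖x‖ₑ := fun x => by
    rw [← ofReal_norm, Complex.norm_real, ofReal_norm]
  unfold normSq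
  rw [ENNReal.tsum_add]
  refine add_le_add ?_ ?_
  · rw [← lintegral_tsum fun k => ((hum k).enorm.pow_const 2).aemeasurable]
    refine lintegral_mono fun ζ => ?_
    have := enorm_iSup_sub_iSup_sq_le (hb ζ) hz
    simpa [hoe] using this
  · unfold dirichletIntegral
    rw [← lintegral_tsum fun k => (measurable_localDirichlet (hum k)).aemeasurable]
    refine lintegral_mono fun ξ => ?_
    have h2 : ∀ k, localDirichlet (fun ζ => (u k ζ : ℂ)) ξ
        = ∫⁻ ζ, ‖diffQuot (fun ζ => (u k ζ : ℂ)) ξ ζ‖ₑ ^ 2 ∂arcMeasure := fun k => rfl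
    simp only [h2]
    rw [← lintegral_tsum fun k => ((measurable_diffQuot (hum k) ξ).enorm.pow_const 2).aemeasurable]
    refine lintegral_mono fun ζ => ?_
    simp only [diffQuot, div_eq_mul_inv, enorm_mul, mul_pow]
    rw [ENNReal.tsum_mul_right]
    refine mul_le_mul' ?_ le_rfl
    have := enorm_iSup_sub_iSup_sq_le (hb ζ) (hb ξ)
    simpa only [← Complex.ofReal_sub, hoe] using this

/-- Countable subadditivity: the supremum of test functions for the sets `A k` is a test function for
their union. -/
lemma capacity_iUnion_le (A : ℕ → Set Circle) :
    capacity μ (⋃ k, A k) ≤ ∑' k, capacity μ (A k) := by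
  refine ENNReal.le_of_forall_pos_le_add fun ε hε _ => ?_
  obtain ⟨δ, hδ, hδs⟩ := ENNReal.exists_pos_sum_of_countable
    (ENNReal.coe_ne_zero.2 hε.ne') ℕ
  have hlt : ∀ k, capacity μ (A k) < capacity μ (A k) + δ k := fun k =>
    ENNReal.lt_add_right ((capacity_le_one _).trans_lt ENNReal.one_lt_top).ne
      (ENNReal.coe_ne_zero.2 (hδ k).ne')
  choose u hum _ hu1 hU hun using fun k => exists_test_of_capacity_lt (hlt k)
  choose U hUo hAU hUu using hU
  have hb : ∀ ζ, BddAbove (Set.range fun k => u k ζ) := fun ζ =>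
    ⟨1, by rintro _ ⟨k, rfl⟩; exact hu1 k ζ⟩
  calc capacity μ (⋃ k, A k)
      ≤ normSq μ (fun ζ => ((⨆ k, u k ζ : ℝ) : ℂ)) := by
        refine capacity_le_normSq (isOpen_iUnion hUo) (Set.iUnion_mono hAU)
          (Complex.measurable_ofReal.comp (Measurable.iSup hum)) ?_
        filter_upwards [ae_all_iff.2 hUu] with ζ hζ hζU
        obtain ⟨k, hk⟩ := Set.mem_iUnion.1 hζU
        rw [Complex.norm_real]
        exact ((hζ k hk).trans (le_ciSup (hb ζ) k)).trans (le_abs_self _)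
    _ ≤ ∑' k, normSq μ (fun ζ => (u k ζ : ℂ)) := normSq_iSup_le hum hu1
    _ ≤ ∑' k, (capacity μ (A k) + δ k) := ENNReal.tsum_le_tsum fun k => (hun k).le
    _ ≤ ∑' k, capacity μ (A k) + ε := by
        rw [ENNReal.tsum_add]
        gcongr

lemma capacity_empty : capacity μ ∅ = 0 := by
  refine le_antisymm ?_ zero_le
  refine (capacity_le_normSq isOpen_empty (Set.Subset.refl _) (f := fun _ => 0)
    measurable_const (by simp)).trans_eq ?_
  simp [normSq, dirichletIntegral, localDirichlet]

lemma capacity_union_le (A B : Set Circle) :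
    capacity μ (A ∪ B) ≤ capacity μ A + capacity μ B := by
  have h := capacity_iUnion_le (μ := μ) fun k : ℕ => if k = 0 then A else if k = 1 then B else ∅
  have h1 : A ∪ B ⊆ ⋃ k : ℕ, if k = 0 then A else if k = 1 then B else ∅ := by
    rintro x (hx | hx)
    · exact Set.mem_iUnion.2 ⟨0, by simpa using hx⟩
    · exact Set.mem_iUnion.2 ⟨1, by simpa using hx⟩
  refine (capacity_mono h1).trans (h.trans ?_)
  rw [tsum_eq_sum (s := Finset.range 2)]
  · simp [Finset.sum_range_succ]
  · intro k hk
    have : k ≠ 0 ∧ k ≠ 1 := by simp at hk; omega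
    simp [this.1, this.2, capacity_empty]

/-- The weak type capacitary inequality for continuous functions. -/
lemma capacity_lt_norm_le {v : Circle → ℂ} (hv : Continuous v) {t : ℝ} (ht : 0 < t) :
    capacity μ {ζ | t < ‖v ζ‖} ≤ ENNReal.ofReal (t⁻¹ ^ 2) * normSq μ v := by
  refine (capacity_le_normSq (isOpen_lt continuous_const hv.norm) (Set.Subset.refl _)
    (f := fun ζ => ((t⁻¹ : ℝ) : ℂ) * v ζ) (hv.measurable.const_mul _)
    (Eventually.of_forall fun ζ hζ => ?_)).trans_eq ?_
  · rw [norm_mul, Complex.norm_real, Real.norm_of_nonneg (by positivity),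
      inv_mul_eq_div, one_le_div ht]
    exact le_of_lt hζ
  · rw [normSq_const_mul, ← ofReal_norm, Complex.norm_real, Real.norm_of_nonneg (by positivity),
      ENNReal.ofReal_pow (by positivity)]

end capacity

/-! ### The local capacity estimate -/

lemma dist_circle (ζ ξ : Circle) : dist ζ ξ = ‖(ζ : ℂ) - ξ‖ := by
  rw [← dist_eq_norm]; rfl

lemma fourierCoefficient_inv_one_sub {r : ℝ} (hr0 : 0 ≤ r) (hr1 : r < 1) (ξ : Circle) (n : ℤ) :
    fourierCoefficient (fun ζ => (1 - (r : ℂ) * ξ * (ζ : ℂ)⁻¹)⁻¹) n =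
      if n ≤ 0 then ((r : ℂ) * ξ) ^ (-n) else 0 := by
  have hi : Integrable (fun ζ : Circle => (ζ : ℂ) ^ (-n)) arcMeasure :=
    ((continuous_coe_zpow (-n)).memLp_arcMeasure 1).integrable le_rfl
  have h1 := dilation_eq_integral hr0 hr1 hi ξ
  have h2 : ∀ k : ℕ, fourierCoefficient (fun ζ : Circle => (ζ : ℂ) ^ (-n)) k
      = if (k : ℤ) = -n then 1 else 0 := by
    intro k
    unfold fourierCoefficient
    simp only [← zpow_add₀ (Circle.coe_ne_zero _), integral_zpow]
    congr 1
    simp only [eq_iff_iff]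
    omega
  have h3 : fourierCoefficient (fun ζ => (1 - (r : ℂ) * ξ * (ζ : ℂ)⁻¹)⁻¹) n
      = dilation r (fun ζ : Circle => (ζ : ℂ) ^ (-n)) ξ := by
    rw [h1]
    unfold fourierCoefficient
    simp only [mul_comm]
  rw [h3, dilation, discExtension]
  simp only [h2]
  split_ifs with hn
  · obtain ⟨k, rfl⟩ : ∃ k : ℕ, n = -(k : ℤ) := ⟨n.natAbs, by omega⟩
    rw [tsum_eq_single k]
    · simp
    · intro j hj
      rw [if_neg (by omega), zero_mul]
  · refine (tsum_congr fun k => ?_).trans tsum_zero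
    rw [if_neg (by omega), zero_mul]

/-- Comparison of `|ζ - ξ|` with `|ζ - r ξ|`, `r = 1 - ρ`, reduces this to the `L²` norm of a
geometric series. -/
lemma lintegral_inv_sub_sq_le (ξ : Circle) {ρ : ℝ} (h0 : 0 < ρ) (h1 : ρ ≤ 1) :
    ∫⁻ ζ in {ζ : Circle | ρ ≤ dist ζ ξ}, ‖((ζ : ℂ) - ξ)⁻¹‖ₑ ^ 2 ∂arcMeasure
      ≤ ENNReal.ofReal (4 / ρ) := by
  set r := 1 - ρ with hr
  have hr0 : 0 ≤ r := by linarith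
  have hr1 : r < 1 := by linarith
  have hc : Continuous fun ζ : Circle => (1 - (r : ℂ) * ξ * (ζ : ℂ)⁻¹)⁻¹ := by
    have h1 : Continuous fun η : Circle => (η : ℂ)⁻¹ :=
      continuous_coe_circle.inv₀ fun η => η.coe_ne_zero
    exact (continuous_const.sub (continuous_const.mul h1)).inv₀
      fun η => one_sub_mul_coe_ne_zero hr0 hr1 ξ η
  have hP : ∫⁻ ζ : Circle, ‖(1 - (r : ℂ) * ξ * (ζ : ℂ)⁻¹)⁻¹‖ₑ ^ 2 ∂arcMeasure
      ≤ ENNReal.ofReal (1 / ρ) := by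
    rw [lintegral_enorm_sq_eq_tsum (hc.memLp_arcMeasure 2)]
    simp only [fourierCoefficient_inv_one_sub hr0 hr1]
    have hinj : Function.Injective fun k : ℕ => -(k : ℤ) := fun a b h => by simpa using h
    rw [← hinj.tsum_eq]
    · have h2 : ∀ k : ℕ, ‖(if -(k : ℤ) ≤ 0 then ((r : ℂ) * ξ) ^ (-(-(k : ℤ))) else 0)‖ₑ ^ 2
          = ENNReal.ofReal ((r ^ 2) ^ k) := by
        intro k
        rw [if_pos (by omega), neg_neg, zpow_natCast, ← ofReal_norm,
          ← ENNReal.ofReal_pow (norm_nonneg _), norm_pow, norm_mul, Circle.norm_coe,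
          Complex.norm_real, Real.norm_of_nonneg hr0, mul_one, pow_right_comm]
      simp only [h2]
      have hr2 : r ^ 2 < 1 := by nlinarith
      rw [← ENNReal.ofReal_tsum_of_nonneg (fun _ => by positivity)
        (summable_geometric_of_lt_one (by positivity) hr2),
        tsum_geometric_of_lt_one (by positivity) hr2, one_div]
      refine ENNReal.ofReal_le_ofReal (inv_anti₀ h0 ?_)
      nlinarith
    · intro n hn
      by_contra h
      have hn0 : ¬ n ≤ 0 := fun h' => h ⟨n.natAbs, by simp only; omega⟩
      simp [hn0] at hn
  calc ∫⁻ ζ in {ζ : Circle | ρ ≤ dist ζ ξ}, ‖((ζ : ℂ) - ξ)⁻¹‖ₑ ^ 2 ∂arcMeasure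
      ≤ ∫⁻ ζ in {ζ : Circle | ρ ≤ dist ζ ξ},
          4 * ‖(1 - (r : ℂ) * ξ * (ζ : ℂ)⁻¹)⁻¹‖ₑ ^ 2 ∂arcMeasure := by
        refine setLIntegral_mono (by have := hc.measurable; fun_prop) fun ζ hζ => ?_
        have h2 : ‖((ζ : ℂ) - ξ)⁻¹‖ₑ ≤ 2 * ‖(1 - (r : ℂ) * ξ * (ζ : ℂ)⁻¹)⁻¹‖ₑ := by
          rw [← ofReal_norm, ← ofReal_norm, ← ENNReal.ofReal_ofNat,
            ← ENNReal.ofReal_mul (by norm_num)]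
          refine ENNReal.ofReal_le_ofReal ?_
          have hd : ρ ≤ ‖(ζ : ℂ) - ξ‖ := by rw [← dist_circle]; exact hζ
          have h3 : ‖1 - (r : ℂ) * ξ * (ζ : ℂ)⁻¹‖ ≤ 2 * ‖(ζ : ℂ) - ξ‖ := by
            have e : 1 - (r : ℂ) * ξ * (ζ : ℂ)⁻¹
                = ((ζ : ℂ) - ξ + ((ρ : ℝ) : ℂ) * ξ) * (ζ : ℂ)⁻¹ := by
              rw [add_mul, sub_mul, mul_inv_cancel₀ ζ.coe_ne_zero, hr]
              push_cast; ring
            rw [e, norm_mul, norm_inv, Circle.norm_coe, inv_one, mul_one]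
            refine (norm_add_le _ _).trans ?_
            rw [norm_mul, Circle.norm_coe, Complex.norm_real, Real.norm_of_nonneg h0.le]
            linarith
          rw [norm_inv, norm_inv, ← div_eq_mul_inv, le_div_iff₀ (norm_pos_iff.2
            (one_sub_mul_coe_ne_zero hr0 hr1 ξ ζ)), inv_mul_le_iff₀ (h0.trans_le hd)]
          exact h3.trans_eq (mul_comm _ _)
        refine (pow_le_pow_left' h2 2).trans_eq ?_
        rw [mul_pow]; norm_num
    _ ≤ ∫⁻ ζ, 4 * ‖(1 - (r : ℂ) * ξ * (ζ : ℂ)⁻¹)⁻¹‖ₑ ^ 2 ∂arcMeasure :=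
        setLIntegral_le_lintegral _ _
    _ ≤ 4 * ENNReal.ofReal (1 / ρ) := by
        rw [lintegral_const_mul' _ _ (by norm_num)]
        gcongr
    _ = ENNReal.ofReal (4 / ρ) := by
        rw [← ENNReal.ofReal_ofNat, ← ENNReal.ofReal_mul (by norm_num)]
        congr 1
        ring

lemma setLIntegral_enorm_sq_eq_ofReal {h : Circle → ℝ} (hc : Continuous h) (J : Set Circle) :
    ∫⁻ ζ in J, ‖h ζ‖ₑ ^ 2 ∂arcMeasure = ENNReal.ofReal (∫ ζ in J, h ζ ^ 2 ∂arcMeasure) := by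
  have hi : Integrable (fun ζ => h ζ ^ 2) (arcMeasure.restrict J) := by
    obtain ⟨C, hC⟩ := isCompact_univ.exists_bound_of_continuousOn (hc.pow 2).continuousOn
    exact Integrable.of_bound (hc.pow 2).aestronglyMeasurable C
      (Eventually.of_forall fun ζ => hC ζ trivial)
  rw [ofReal_integral_eq_lintegral_ofReal hi (Eventually.of_forall fun _ => sq_nonneg _)]
  refine lintegral_congr fun ζ => ?_
  rw [← sq_abs, ENNReal.ofReal_pow (abs_nonneg _), ← Real.norm_eq_abs, ofReal_norm]

lemma _root_.Continuous.integrable_arcMeasure {h : Circle → ℝ} (hc : Continuous h) :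
    Integrable h arcMeasure := by
  obtain ⟨C, hC⟩ := isCompact_univ.exists_bound_of_continuousOn hc.continuousOn
  exact Integrable.of_bound hc.aestronglyMeasurable C
    (Eventually.of_forall fun ζ => hC ζ trivial)

lemma setLIntegral_add_measure_eq {g : Circle → ℝ} (hg : Continuous g) {J : Set Circle}
    (h0 : ∫ ζ in J, g ζ ∂arcMeasure = 0) (c : ℝ) :
    ∫⁻ ζ in J, ‖g ζ‖ₑ ^ 2 ∂arcMeasure + ‖c‖ₑ ^ 2 * arcMeasure J
      = ∫⁻ ζ in J, ‖g ζ - c‖ₑ ^ 2 ∂arcMeasure := by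
  rw [setLIntegral_enorm_sq_eq_ofReal hg,
    setLIntegral_enorm_sq_eq_ofReal (h := fun ζ => g ζ - c) (hg.sub continuous_const)]
  have h1 : ∫ ζ in J, (g ζ - c) ^ 2 ∂arcMeasure
      = ∫ ζ in J, g ζ ^ 2 ∂arcMeasure + c ^ 2 * arcMeasure.real J := by
    have e : ∀ ζ, (g ζ - c) ^ 2 = g ζ ^ 2 + ((-2 * c) * g ζ + c ^ 2) := fun ζ => by ring
    simp only [e]
    have i1 : Continuous fun ζ => g ζ ^ 2 := by fun_prop
    have i2 : Continuous fun ζ => (-2 * c) * g ζ := by fun_prop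
    have i3 : Continuous fun ζ => (-2 * c) * g ζ + c ^ 2 := by fun_prop
    rw [integral_add i1.integrable_arcMeasure.integrableOn i3.integrable_arcMeasure.integrableOn,
      integral_add i2.integrable_arcMeasure.integrableOn (integrable_const _),
      integral_const_mul, h0, mul_zero, zero_add, setIntegral_const,
      smul_eq_mul, mul_comm]
  rw [h1, ENNReal.ofReal_add (integral_nonneg fun _ => sq_nonneg _) (by positivity),
    ENNReal.ofReal_mul (sq_nonneg _), ofReal_measureReal, ← sq_abs c,
    ENNReal.ofReal_pow (abs_nonneg _), ← Real.norm_eq_abs, ofReal_norm]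

/-- The part of `‖v‖_μ²` carried by the points `ζ ∈ J`: the variable `ξ` of the measure `μ` runs
over the whole circle.  It is countably additive in `J`. -/
def localEnergy (μ : Measure Circle) (J : Set Circle) (v : Circle → ℂ) : ℝ≥0∞ :=
  (∫⁻ ζ in J, ‖v ζ‖ₑ ^ 2 ∂arcMeasure) + ∫⁻ ξ, ∫⁻ ζ in J, ‖diffQuot v ξ ζ‖ₑ ^ 2 ∂arcMeasure ∂μ

/-- The Lipschitz cutoff function that is `1` on `I` and `0` at distance at least `ρ` from `I`. -/
def cutoff (I : Set Circle) (ρ : ℝ) (ζ : Circle) : ℝ := max 0 (1 - Metric.infDist ζ I / ρ)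

section cutoff

variable {I : Set Circle} {ρ : ℝ}

lemma continuous_cutoff : Continuous (cutoff I ρ) :=
  continuous_const.max (continuous_const.sub ((Metric.continuous_infDist_pt I).div_const ρ))

lemma cutoff_nonneg (ζ : Circle) : 0 ≤ cutoff I ρ ζ := le_max_left _ _

lemma cutoff_le_one (hρ : 0 < ρ) (ζ : Circle) : cutoff I ρ ζ ≤ 1 :=
  max_le zero_le_one (sub_le_self _ (div_nonneg Metric.infDist_nonneg hρ.le))

lemma cutoff_eq_one {ζ : Circle} (h : ζ ∈ I) : cutoff I ρ ζ = 1 := by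
  simp [cutoff, Metric.infDist_zero_of_mem h]

lemma infDist_lt_of_cutoff_ne_zero (hρ : 0 < ρ) {ζ : Circle} (h : cutoff I ρ ζ ≠ 0) :
    Metric.infDist ζ I < ρ := by
  by_contra h1
  refine h (max_eq_left ?_)
  rw [sub_nonpos, one_le_div hρ]
  exact not_lt.1 h1

lemma abs_cutoff_sub_le (hρ : 0 < ρ) (ζ ξ : Circle) :
    |cutoff I ρ ζ - cutoff I ρ ξ| ≤ dist ζ ξ / ρ := by
  refine (abs_max_sub_max_le_max _ _ _ _).trans ?_
  rw [sub_self, abs_zero, max_eq_right (abs_nonneg _), sub_sub_sub_cancel_left, ← sub_div, abs_div,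
    abs_of_pos hρ]
  gcongr
  rw [abs_le]
  constructor
  · have := Metric.infDist_le_infDist_add_dist (s := I) (x := ζ) (y := ξ)
    linarith
  · have := Metric.infDist_le_infDist_add_dist (s := I) (x := ξ) (y := ζ)
    rw [dist_comm] at this
    linarith

end cutoff

lemma enorm_ofReal_complex (x : ℝ) : ‖(x : ℂ)‖ₑ = ‖x‖ₑ := by
  rw [← ofReal_norm, Complex.norm_real, ofReal_norm]

section localEstimate

variable {I J : Set Circle} {ρ M : ℝ}

/-- The bound holds for the vertex `ξ` at any distance from `J`.  The scale is
`s = max ρ (dist ξ J)`: on `J` the difference quotient of the cutoff is at most `1 / s`, and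
`|ζ - ξ| ≤ (1 + M) s`, so the term with the cutoff is controlled because `g` has mean zero on
`J`. -/
lemma setLIntegral_diffQuot_cutoff_mul_le (hρ : 0 < ρ) (hM : 0 ≤ M)
    (hdiam : ∀ ζ ∈ J, ∀ ζ' ∈ J, dist ζ ζ' ≤ M * ρ)
    {g : Circle → ℝ} (hg : Continuous g) (h0 : ∫ ζ in J, g ζ ∂arcMeasure = 0) (ξ : Circle) :
    ∫⁻ ζ in J, ‖diffQuot (fun ζ => ((cutoff I ρ ζ * g ζ : ℝ) : ℂ)) ξ ζ‖ₑ ^ 2 ∂arcMeasure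
      ≤ ENNReal.ofReal (2 + 2 * (1 + M) ^ 2) *
        ∫⁻ ζ in J, ‖diffQuot (fun ζ => (g ζ : ℂ)) ξ ζ‖ₑ ^ 2 ∂arcMeasure := by
  set s := max ρ (Metric.infDist ξ J) with hs
  have hs0 : 0 < s := hρ.trans_le (le_max_left _ _)
  have hgm : Measurable fun ζ => (g ζ : ℂ) := Complex.measurable_ofReal.comp hg.measurable
  have hqm := measurable_diffQuot hgm ξ
  -- at distance `≥ dist ξ J` the trivial bound `|χ ζ - χ ξ| ≤ 1` is used, else the Lipschitz bound
  have hchi : ∀ ζ ∈ J, |cutoff I ρ ζ - cutoff I ρ ξ| ≤ dist ζ ξ / s := by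
    intro ζ hζ
    rcases max_choice ρ (Metric.infDist ξ J) with h | h
    · rw [hs, h]; exact abs_cutoff_sub_le hρ ζ ξ
    · rw [le_div_iff₀ hs0]
      have h1 : |cutoff I ρ ζ - cutoff I ρ ξ| ≤ 1 := by
        rw [abs_le]
        have := cutoff_nonneg (I := I) (ρ := ρ) ζ
        have := cutoff_nonneg (I := I) (ρ := ρ) ξ
        have := cutoff_le_one (I := I) hρ ζ
        have := cutoff_le_one (I := I) hρ ξ
        constructor <;> linarith
      have h2 : s ≤ dist ζ ξ := by
        rw [hs, h, dist_comm]; exact Metric.infDist_le_dist_of_mem hζ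
      calc _ ≤ 1 * s := by gcongr
        _ ≤ dist ζ ξ := by rwa [one_mul]
  have hdist : ∀ ζ ∈ J, dist ζ ξ ≤ (1 + M) * s := by
    intro ζ hζ
    have h1 : Metric.diam J ≤ M * ρ := Metric.diam_le_of_forall_dist_le (by positivity) hdiam
    have h2 := Metric.dist_le_infDist_add_diam (x := ξ)
      (Metric.isBounded_iff.2 ⟨M * ρ, fun a ha b hb => hdiam a ha b hb⟩) hζ
    rw [dist_comm]
    have h3 : Metric.infDist ξ J ≤ s := le_max_right _ _
    have h4 : M * ρ ≤ M * s := by gcongr; exact le_max_left _ _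
    linarith
  have hV : ∫⁻ ζ in J, ‖g ζ‖ₑ ^ 2 ∂arcMeasure ≤ ENNReal.ofReal (((1 + M) * s) ^ 2) *
      ∫⁻ ζ in J, ‖diffQuot (fun ζ => (g ζ : ℂ)) ξ ζ‖ₑ ^ 2 ∂arcMeasure := by
    refine (le_self_add.trans (setLIntegral_add_measure_eq hg h0 (g ξ)).le).trans ?_
    rw [← lintegral_const_mul' _ _ (by finiteness)]
    refine setLIntegral_mono (by fun_prop) fun ζ hζ => ?_
    rw [← enorm_ofReal_complex, Complex.ofReal_sub,
      ← diffQuot_mul_sub (fun ζ => (g ζ : ℂ)) ξ ζ, enorm_mul, mul_pow, mul_comm]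
    gcongr
    rw [← ofReal_norm, ← ENNReal.ofReal_pow (norm_nonneg _), ← dist_circle]
    refine ENNReal.ofReal_le_ofReal ?_
    have := hdist ζ hζ
    gcongr
  have hpt : ∀ ζ ∈ J, ‖diffQuot (fun ζ => ((cutoff I ρ ζ * g ζ : ℝ) : ℂ)) ξ ζ‖ₑ ^ 2
      ≤ 2 * ‖diffQuot (fun ζ => (g ζ : ℂ)) ξ ζ‖ₑ ^ 2
        + ENNReal.ofReal (2 / s ^ 2) * ‖g ζ‖ₑ ^ 2 := by
    intro ζ hζ
    have e : diffQuot (fun ζ => ((cutoff I ρ ζ * g ζ : ℝ) : ℂ)) ξ ζ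
        = (cutoff I ρ ξ : ℂ) * diffQuot (fun ζ => (g ζ : ℂ)) ξ ζ
          + g ζ * (((cutoff I ρ ζ - cutoff I ρ ξ : ℝ) : ℂ) / ((ζ : ℂ) - ξ)) := by
      simp only [diffQuot]; push_cast; ring
    rw [e]
    refine (enorm_add_sq_le _ _).trans (add_le_add ?_ ?_)
    · gcongr
      rw [enorm_mul, enorm_ofReal_complex]
      refine mul_le_of_le_one_left' ?_
      rw [← enorm_one (G := ℝ), enorm_le_iff_norm_le, norm_one,
        Real.norm_of_nonneg (cutoff_nonneg _)]
      exact cutoff_le_one hρ ξ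
    · have h1 : ‖((cutoff I ρ ζ - cutoff I ρ ξ : ℝ) : ℂ) / ((ζ : ℂ) - ξ)‖ ≤ 1 / s := by
        rw [norm_div, Complex.norm_real, Real.norm_eq_abs, ← dist_circle]
        refine div_le_of_le_mul₀ dist_nonneg (by positivity) ?_
        rw [one_div_mul_eq_div]
        exact hchi ζ hζ
      rw [enorm_mul, enorm_ofReal_complex, mul_pow, mul_comm (‖g ζ‖ₑ ^ 2), ← mul_assoc]
      gcongr
      rw [← ofReal_norm, ← ENNReal.ofReal_pow (norm_nonneg _), ← ENNReal.ofReal_ofNat,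
        ← ENNReal.ofReal_mul (by norm_num)]
      refine ENNReal.ofReal_le_ofReal ?_
      calc 2 * ‖((cutoff I ρ ζ - cutoff I ρ ξ : ℝ) : ℂ) / ((ζ : ℂ) - ξ)‖ ^ 2 ≤ 2 * (1 / s) ^ 2 := by
            gcongr
        _ = 2 / s ^ 2 := by ring
  calc _ ≤ ∫⁻ ζ in J, (2 * ‖diffQuot (fun ζ => (g ζ : ℂ)) ξ ζ‖ₑ ^ 2
        + ENNReal.ofReal (2 / s ^ 2) * ‖g ζ‖ₑ ^ 2) ∂arcMeasure := by
        refine setLIntegral_mono ?_ hpt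
        have := hg.measurable
        fun_prop
    _ = 2 * (∫⁻ ζ in J, ‖diffQuot (fun ζ => (g ζ : ℂ)) ξ ζ‖ₑ ^ 2 ∂arcMeasure)
        + ENNReal.ofReal (2 / s ^ 2) * ∫⁻ ζ in J, ‖g ζ‖ₑ ^ 2 ∂arcMeasure := by
        rw [lintegral_add_left (by fun_prop), lintegral_const_mul' _ _ (by norm_num),
          lintegral_const_mul' _ _ (by finiteness)]
    _ ≤ 2 * (∫⁻ ζ in J, ‖diffQuot (fun ζ => (g ζ : ℂ)) ξ ζ‖ₑ ^ 2 ∂arcMeasure)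
        + ENNReal.ofReal (2 / s ^ 2) * (ENNReal.ofReal (((1 + M) * s) ^ 2) *
      ∫⁻ ζ in J, ‖diffQuot (fun ζ => (g ζ : ℂ)) ξ ζ‖ₑ ^ 2 ∂arcMeasure) := by gcongr
    _ = _ := by
        rw [← mul_assoc, ← add_mul, ← ENNReal.ofReal_mul (by positivity), ← ENNReal.ofReal_ofNat,
          ← ENNReal.ofReal_add (by norm_num) (by positivity)]
        congr 2
        field_simp

lemma setLIntegral_compl_diffQuot_cutoff_mul_le (hρ : 0 < ρ) (hρ1 : ρ ≤ 1)
    (hfar : ∀ ζ, ζ ∉ J → 2 * ρ ≤ Metric.infDist ζ I)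
    (hdiam : ∀ ζ ∈ J, ∀ ζ' ∈ J, dist ζ ζ' ≤ M * ρ) (hJ : MeasurableSet J)
    (hm : ENNReal.ofReal ρ ≤ arcMeasure J)
    {g : Circle → ℝ} (hg : Continuous g) (h0 : ∫ ζ in J, g ζ ∂arcMeasure = 0) (ξ : Circle) :
    ∫⁻ ζ in Jᶜ, ‖diffQuot (fun ζ => ((cutoff I ρ ζ * g ζ : ℝ) : ℂ)) ξ ζ‖ₑ ^ 2 ∂arcMeasure
      ≤ ENNReal.ofReal (4 * M ^ 2) *
        ∫⁻ ζ in J, ‖diffQuot (fun ζ => (g ζ : ℂ)) ξ ζ‖ₑ ^ 2 ∂arcMeasure := by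
  have hgm : Measurable fun ζ => (g ζ : ℂ) := Complex.measurable_ofReal.comp hg.measurable
  have hqm := measurable_diffQuot hgm ξ
  have hχ0 : ∀ ζ, ζ ∉ J → cutoff I ρ ζ = 0 := by
    intro ζ hζ
    by_contra h
    have := infDist_lt_of_cutoff_ne_zero hρ h
    have := hfar ζ hζ
    linarith
  by_cases hξ : cutoff I ρ ξ = 0
  · rw [setLIntegral_congr_fun hJ.compl (g := fun _ => 0)]
    · simp
    · intro ζ hζ
      simp [diffQuot, hχ0 ζ hζ, hξ]
  have hξI := infDist_lt_of_cutoff_ne_zero hρ hξ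
  have hξJ : ξ ∈ J := by_contra fun h => hξ (hχ0 ξ h)
  have hfarξ : ∀ ζ ∈ Jᶜ, ρ ≤ dist ζ ξ := by
    intro ζ hζ
    have := hfar ζ hζ
    have := Metric.infDist_le_infDist_add_dist (s := I) (x := ζ) (y := ξ)
    linarith
  have hV : ENNReal.ofReal ρ * ‖g ξ‖ₑ ^ 2 ≤ ENNReal.ofReal ((M * ρ) ^ 2) *
      ∫⁻ ζ in J, ‖diffQuot (fun ζ => (g ζ : ℂ)) ξ ζ‖ₑ ^ 2 ∂arcMeasure := by
    rw [mul_comm]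
    refine (mul_le_mul' le_rfl hm).trans
      ((le_add_self.trans (setLIntegral_add_measure_eq hg h0 (g ξ)).le).trans ?_)
    rw [← lintegral_const_mul' _ _ (by finiteness)]
    refine setLIntegral_mono (by fun_prop) fun ζ hζ => ?_
    rw [← enorm_ofReal_complex, Complex.ofReal_sub,
      ← diffQuot_mul_sub (fun ζ => (g ζ : ℂ)) ξ ζ, enorm_mul, mul_pow, mul_comm]
    gcongr
    rw [← ofReal_norm, ← ENNReal.ofReal_pow (norm_nonneg _), ← dist_circle]
    refine ENNReal.ofReal_le_ofReal ?_
    have := hdiam ζ hζ ξ hξJ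
    gcongr
  calc _ ≤ ∫⁻ ζ in Jᶜ, ‖g ξ‖ₑ ^ 2 * ‖((ζ : ℂ) - ξ)⁻¹‖ₑ ^ 2 ∂arcMeasure := by
        refine setLIntegral_mono ?_ fun ζ hζ => ?_
        · have := continuous_coe_circle.measurable
          fun_prop
        · rw [diffQuot, hχ0 ζ hζ, zero_mul, Complex.ofReal_zero, zero_sub, div_eq_mul_inv,
            enorm_mul, enorm_neg, mul_pow, enorm_ofReal_complex, enorm_mul]
          gcongr
          refine mul_le_of_le_one_left' ?_
          rw [← enorm_one (G := ℝ), enorm_le_iff_norm_le, norm_one,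
            Real.norm_of_nonneg (cutoff_nonneg _)]
          exact cutoff_le_one hρ ξ
    _ = ‖g ξ‖ₑ ^ 2 * ∫⁻ ζ in Jᶜ, ‖((ζ : ℂ) - ξ)⁻¹‖ₑ ^ 2 ∂arcMeasure :=
        lintegral_const_mul' _ _ (by finiteness)
    _ ≤ ‖g ξ‖ₑ ^ 2 * ENNReal.ofReal (4 / ρ) := by
        gcongr
        exact (lintegral_mono_set hfarξ).trans (lintegral_inv_sub_sq_le ξ hρ hρ1)
    _ = ENNReal.ofReal (4 / ρ ^ 2) * (ENNReal.ofReal ρ * ‖g ξ‖ₑ ^ 2) := by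
        rw [← mul_assoc, ← ENNReal.ofReal_mul (by positivity), mul_comm]
        congr 2
        field_simp
    _ ≤ ENNReal.ofReal (4 / ρ ^ 2) * (ENNReal.ofReal ((M * ρ) ^ 2) *
      ∫⁻ ζ in J, ‖diffQuot (fun ζ => (g ζ : ℂ)) ξ ζ‖ₑ ^ 2 ∂arcMeasure) := by gcongr
    _ = _ := by
        rw [← mul_assoc, ← ENNReal.ofReal_mul (by positivity)]
        congr 2
        field_simp

/-- The constant of the local estimate, where the diameter of `J` is at most `M ρ` and the cutoff
lives at scale `ρ`. -/
def localConst (M : ℝ) : ℝ := 2 + 2 * (1 + M) ^ 2 + 4 * M ^ 2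

lemma normSq_cutoff_mul_le (μ : Measure Circle) (hρ : 0 < ρ) (hρ1 : ρ ≤ 1) (hM : 0 ≤ M)
    (hfar : ∀ ζ, ζ ∉ J → 2 * ρ ≤ Metric.infDist ζ I)
    (hdiam : ∀ ζ ∈ J, ∀ ζ' ∈ J, dist ζ ζ' ≤ M * ρ) (hJ : MeasurableSet J)
    (hm : ENNReal.ofReal ρ ≤ arcMeasure J)
    {g : Circle → ℝ} (hg : Continuous g) (h0 : ∫ ζ in J, g ζ ∂arcMeasure = 0) :
    normSq μ (fun ζ => ((cutoff I ρ ζ * g ζ : ℝ) : ℂ))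
      ≤ ENNReal.ofReal (localConst M) * localEnergy μ J (fun ζ => (g ζ : ℂ)) := by
  rw [localEnergy, mul_add]
  refine add_le_add ?_ ?_
  · have hχ0 : ∀ ζ, ζ ∉ J → cutoff I ρ ζ = 0 := by
      intro ζ hζ
      by_contra h
      have := infDist_lt_of_cutoff_ne_zero hρ h
      have := hfar ζ hζ
      linarith
    have h1 : (1 : ℝ≥0∞) ≤ ENNReal.ofReal (localConst M) := by
      rw [ENNReal.one_le_ofReal, localConst]
      nlinarith [sq_nonneg (1 + M), sq_nonneg M]
    refine le_trans ?_ (le_mul_of_one_le_left' h1)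
    rw [← lintegral_indicator hJ]
    refine lintegral_mono fun ζ => ?_
    by_cases hζ : ζ ∈ J
    · rw [Set.indicator_of_mem hζ]
      simp only [enorm_ofReal_complex, enorm_mul]
      gcongr
      refine mul_le_of_le_one_left' ?_
      rw [← enorm_one (G := ℝ), enorm_le_iff_norm_le, norm_one,
        Real.norm_of_nonneg (cutoff_nonneg _)]
      exact cutoff_le_one hρ ζ
    · simp [hχ0 ζ hζ]
  · rw [dirichletIntegral, ← lintegral_const_mul' _ _ (by finiteness)]
    refine lintegral_mono fun ξ => ?_
    have h2 : localDirichlet (fun ζ => ((cutoff I ρ ζ * g ζ : ℝ) : ℂ)) ξ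
        = (∫⁻ ζ in J, ‖diffQuot (fun ζ => ((cutoff I ρ ζ * g ζ : ℝ) : ℂ)) ξ ζ‖ₑ ^ 2 ∂arcMeasure)
        + ∫⁻ ζ in Jᶜ, ‖diffQuot (fun ζ => ((cutoff I ρ ζ * g ζ : ℝ) : ℂ)) ξ ζ‖ₑ ^ 2 ∂arcMeasure :=
      (lintegral_add_compl _ hJ).symm
    rw [h2, localConst, ENNReal.ofReal_add (by positivity) (by positivity), add_mul]
    exact add_le_add (setLIntegral_diffQuot_cutoff_mul_le hρ hM hdiam hg h0 ξ)
      (setLIntegral_compl_diffQuot_cutoff_mul_le hρ hρ1 hfar hdiam hJ hm hg h0 ξ)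

/-- The sublevel set `{|v| < δ}` of a continuous function inside `I` has small capacity when the
mean `m` of `|v|` over `J` exceeds `δ`: the cutoff of `m - |v|`, divided by `m - δ`, is a test function,
and its energy is bounded by that of `v` because `m - |v|` has mean zero on `J`. -/
lemma capacity_sublevel_le (μ : Measure Circle) (hI : IsOpen I) (hρ : 0 < ρ) (hρ1 : ρ ≤ 1)
    (hM : 0 ≤ M) (hfar : ∀ ζ, ζ ∉ J → 2 * ρ ≤ Metric.infDist ζ I)
    (hdiam : ∀ ζ ∈ J, ∀ ζ' ∈ J, dist ζ ζ' ≤ M * ρ) (hJ : MeasurableSet J)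
    (hm : ENNReal.ofReal ρ ≤ arcMeasure J) {v : Circle → ℂ} (hv : Continuous v) {δ : ℝ}
    (hδ : δ < (arcMeasure.real J)⁻¹ * ∫ ζ in J, ‖v ζ‖ ∂arcMeasure) :
    capacity μ (I ∩ {ζ | ‖v ζ‖ < δ})
      ≤ ENNReal.ofReal (((arcMeasure.real J)⁻¹ * (∫ ζ in J, ‖v ζ‖ ∂arcMeasure) - δ)⁻¹ ^ 2)
        * (ENNReal.ofReal (localConst M) * localEnergy μ J v) := by
  set m := (arcMeasure.real J)⁻¹ * ∫ ζ in J, ‖v ζ‖ ∂arcMeasure with hmdef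
  have hJ0 : arcMeasure.real J ≠ 0 := by
    intro h
    have : arcMeasure J = 0 := by
      rwa [measureReal_def, ENNReal.toReal_eq_zero_iff, or_iff_left (measure_ne_top _ _)] at h
    rw [this, nonpos_iff_eq_zero, ENNReal.ofReal_eq_zero] at hm
    linarith
  set g : Circle → ℝ := fun ζ => m - ‖v ζ‖ with hgdef
  have hg : Continuous g := continuous_const.sub hv.norm
  have h0 : ∫ ζ in J, g ζ ∂arcMeasure = 0 := by
    rw [hgdef, integral_sub (integrable_const _) hv.norm.integrable_arcMeasure.integrableOn,
      setIntegral_const, smul_eq_mul, hmdef, mul_inv_cancel_left₀ hJ0, sub_self]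
  have hE : localEnergy μ J (fun ζ => (g ζ : ℂ)) ≤ localEnergy μ J v := by
    refine add_le_add ?_ ?_
    · have h1 := setLIntegral_add_measure_eq hg h0 m
      simp only [enorm_ofReal_complex]
      refine (le_self_add.trans h1.le).trans_eq ?_
      refine lintegral_congr fun ζ => ?_
      rw [hgdef, sub_sub_cancel_left, enorm_neg, enorm_norm]
    · refine lintegral_mono fun ξ => lintegral_mono fun ζ => pow_le_pow_left' ?_ 2
      rw [enorm_le_iff_norm_le, diffQuot, diffQuot, norm_div, norm_div]
      gcongr
      rw [← Complex.ofReal_sub, Complex.norm_real, Real.norm_eq_abs, hgdef,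
        sub_sub_sub_cancel_left, abs_sub_comm]
      exact abs_norm_sub_norm_le _ _
  have hmδ : 0 < m - δ := by linarith
  calc capacity μ (I ∩ {ζ | ‖v ζ‖ < δ})
      ≤ normSq μ (fun ζ => (((m - δ)⁻¹ : ℝ) : ℂ) * ((cutoff I ρ ζ * g ζ : ℝ) : ℂ)) := by
        refine capacity_le_normSq (hI.inter (isOpen_lt hv.norm continuous_const))
          (Set.Subset.refl _) ?_ (Eventually.of_forall fun ζ hζ => ?_)
        · exact (Complex.measurable_ofReal.comp
            (continuous_cutoff.mul hg).measurable).const_mul _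
        · rw [cutoff_eq_one hζ.1, one_mul, ← Complex.ofReal_mul, Complex.norm_real]
          refine le_trans ?_ (le_abs_self _)
          rw [inv_mul_eq_div, one_le_div hmδ]
          have : ‖v ζ‖ < δ := hζ.2
          simp only [hgdef]
          linarith
    _ ≤ _ := by
        rw [normSq_const_mul, enorm_ofReal_complex, ← ofReal_norm,
          Real.norm_of_nonneg (by positivity), ← ENNReal.ofReal_pow (by positivity)]
        gcongr
        exact (normSq_cutoff_mul_le μ hρ hρ1 hM hfar hdiam hJ hm hg h0).trans
          (mul_le_mul' le_rfl hE)

end localEstimate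

/-! ### Geometry of arcs -/

lemma dist_exp_exp (t s : ℝ) :
    dist (Circle.exp t) (Circle.exp s) = 2 * |Real.sin ((t - s) / 2)| := by
  rw [dist_circle]
  have h1 : ((Circle.exp t : Circle) : ℂ) - (Circle.exp s : Circle)
      = (Circle.exp s : Circle) * (Complex.exp (Complex.I * ((t - s : ℝ) : ℂ)) - 1) := by
    rw [mul_sub_one, Circle.coe_exp, Circle.coe_exp, ← Complex.exp_add]
    congr 2
    push_cast; ring
  rw [h1, norm_mul, Circle.norm_coe, one_mul, Complex.norm_exp_I_mul_ofReal_sub_one, norm_mul]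
  simp

lemma exists_exp_eq_mem_Ioc (ζ : Circle) (t : ℝ) :
    ∃ s ∈ Set.Ioc t (t + 2 * Real.pi), Circle.exp s = ζ := by
  obtain ⟨s, rfl⟩ := Circle.exp_surjective ζ
  obtain ⟨s', hs', h⟩ := Circle.periodic_exp.exists_mem_Ioc Real.two_pi_pos s t
  exact ⟨s', hs', h.symm⟩

lemma arc_eq_univ {a b : ℝ} (h : a + 2 * Real.pi < b) : arc a b = Set.univ := by
  refine Set.eq_univ_of_forall fun ζ => ?_
  obtain ⟨s, hs, rfl⟩ := exists_exp_eq_mem_Ioc ζ a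
  exact ⟨s, ⟨hs.1, hs.2.trans_lt h⟩, rfl⟩

section enlarged

variable {γ a b : ℝ}

lemma nonempty_arc (hab : a < b) : (arc a b).Nonempty := (Set.nonempty_Ioo.2 hab).image _

lemma nonempty_enlargedArc (hγ : 1 < γ) (hab : a < b) : (enlargedArc γ a b).Nonempty := by
  refine nonempty_arc ?_
  have : 0 ≤ (γ - 1) * ((b - a) / 2) := mul_nonneg (by linarith) (by linarith)
  linarith

lemma length_le_of_enlargedArc_ne_univ (h : enlargedArc γ a b ≠ Set.univ) :
    γ * (b - a) ≤ 2 * Real.pi := by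
  by_contra h1
  refine h (arc_eq_univ ?_)
  linarith

lemma arcMeasure_enlargedArc (h : γ * (b - a) ≤ 2 * Real.pi) :
    arcMeasure (enlargedArc γ a b) = ENNReal.ofReal (γ * (b - a) / (2 * Real.pi)) := by
  rw [enlargedArc, arcMeasure_arc (by linarith)]
  congr 1
  ring

lemma dist_le_of_mem_enlargedArc {ζ ξ : Circle} (hζ : ζ ∈ enlargedArc γ a b)
    (hξ : ξ ∈ enlargedArc γ a b) : dist ζ ξ ≤ γ * (b - a) := by
  obtain ⟨t, ht, rfl⟩ := hζ
  obtain ⟨s, hs, rfl⟩ := hξ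
  rw [dist_exp_exp]
  have h1 : |Real.sin ((t - s) / 2)| ≤ |(t - s) / 2| := Real.abs_sin_le_abs
  have h2 : |t - s| ≤ γ * (b - a) := by
    rw [abs_le]
    constructor <;> linarith [ht.1, ht.2, hs.1, hs.2]
  rw [abs_div, abs_two] at h1
  linarith

lemma le_infDist_of_notMem_enlargedArc (hγ : 1 < γ) (hab : a < b) {ζ : Circle}
    (hζ : ζ ∉ enlargedArc γ a b) :
    2 * ((γ - 1) * (b - a) / (2 * Real.pi)) ≤ Metric.infDist ζ (arc a b) := by
  have hπ := Real.pi_pos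
  rw [Metric.le_infDist (nonempty_arc hab)]
  rintro _ ⟨s, hs, rfl⟩
  set δ := (γ - 1) * ((b - a) / 2) with hδ
  have hδ0 : 0 < δ := mul_pos (by linarith) (by linarith)
  obtain ⟨t, ht, rfl⟩ := exists_exp_eq_mem_Ioc ζ (a - δ)
  have htb : b + δ ≤ t := by
    by_contra h
    exact hζ ⟨t, ⟨ht.1, not_le.1 h⟩, rfl⟩
  rw [dist_exp_exp]
  have h1 : δ ≤ t - s := by linarith [hs.2]
  have h2 : t - s ≤ 2 * Real.pi - δ := by linarith [hs.1, ht.2]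
  have h3 : 2 / Real.pi * (δ / 2) ≤ Real.sin ((t - s) / 2) := by
    rcases le_total ((t - s) / 2) (Real.pi / 2) with h | h
    · refine le_trans ?_ (Real.mul_le_sin (by linarith) h)
      gcongr
    · rw [← Real.sin_pi_sub]
      refine le_trans ?_ (Real.mul_le_sin (by linarith) (by linarith))
      gcongr
      linarith
  have h4 : 2 * ((γ - 1) * (b - a) / (2 * Real.pi)) = 2 * (2 / Real.pi * (δ / 2)) := by
    rw [hδ]; field_simp
  rw [h4]
  gcongr
  exact h3.trans (le_abs_self _)

end enlarged

/-! ### Zeros at quasi-every point -/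

lemma tendsto_lintegral_enorm_of_sq {h : ℕ → Circle → ℂ} (hm : ∀ k, Measurable (h k))
    (hh : Tendsto (fun k => ∫⁻ ζ, ‖h k ζ‖ₑ ^ 2 ∂arcMeasure) atTop (𝓝 0)) :
    Tendsto (fun k => ∫⁻ ζ, ‖h k ζ‖ₑ ∂arcMeasure) atTop (𝓝 0) := by
  have h1 : Tendsto (fun k => (∫⁻ ζ, ‖h k ζ‖ₑ ^ 2 ∂arcMeasure) ^ (1 / 2 : ℝ)) atTop (𝓝 0) := by
    have := (ENNReal.continuous_rpow_const (y := 1 / 2)).tendsto 0 |>.comp hh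
    simpa [Function.comp_def] using this
  refine tendsto_of_tendsto_of_tendsto_of_le_of_le tendsto_const_nhds h1
    (fun _ => zero_le) fun k => ?_
  have h2 := eLpNorm_le_eLpNorm_of_exponent_le (μ := arcMeasure) (p := 1) (q := 2)
    (by norm_num) (hm k).aestronglyMeasurable
  rw [eLpNorm_one_eq_lintegral_enorm,
    eLpNorm_eq_lintegral_rpow_enorm_toReal (by norm_num) (by norm_num)] at h2
  simpa using h2

lemma tendsto_setIntegral_norm_of_sq {u : ℕ → Circle → ℂ} {f : Circle → ℂ}
    (hu : ∀ k, Measurable (u k)) (hf : Measurable f) (hui : ∀ k, Integrable (u k) arcMeasure)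
    (hfi : Integrable f arcMeasure)
    (h : Tendsto (fun k => ∫⁻ ζ, ‖u k ζ - f ζ‖ₑ ^ 2 ∂arcMeasure) atTop (𝓝 0)) (J : Set Circle) :
    Tendsto (fun k => ∫ ζ in J, ‖u k ζ‖ ∂arcMeasure) atTop (𝓝 (∫ ζ in J, ‖f ζ‖ ∂arcMeasure)) := by
  refine tendsto_setIntegral_of_L1 (fun ζ => ‖f ζ‖) hfi.norm.aestronglyMeasurable
    (Eventually.of_forall fun k => (hui k).norm) ?_ J
  refine tendsto_of_tendsto_of_tendsto_of_le_of_le tendsto_const_nhds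
    (tendsto_lintegral_enorm_of_sq (h := fun k ζ => u k ζ - f ζ)
      (fun k => (hu k).sub hf) h) (fun _ => zero_le) fun k => ?_
  refine lintegral_mono fun ζ => ?_
  rw [enorm_le_iff_norm_le, Real.norm_eq_abs]
  exact abs_norm_sub_norm_le _ _

lemma tendsto_dilation_of_hasNontangentialLimit {f : Circle → ℂ} {ζ : Circle} {l : ℂ}
    (h : HasNontangentialLimit (discExtension f) ζ l) {r : ℕ → ℝ}
    (hr0 : ∀ k, 0 ≤ r k) (hr1 : ∀ k, r k < 1) (hr : Tendsto r atTop (𝓝 1)) :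
    Tendsto (fun k => dilation (r k) f ζ) atTop (𝓝 l) := by
  refine (h 2 one_lt_two).comp (tendsto_nhdsWithin_iff.2 ⟨?_, Eventually.of_forall fun k => ?_⟩)
  · have h1 := ((Complex.continuous_ofReal.tendsto 1).comp hr).mul_const (ζ : ℂ)
    simpa [Function.comp_def] using h1
  · have h1 : ‖(r k : ℂ) * ζ‖ = r k := by simp [abs_of_nonneg (hr0 k), Circle.norm_coe]
    have h2 : ‖(r k : ℂ) * ζ - ζ‖ = 1 - r k := by
      rw [← sub_one_mul, norm_mul, Circle.norm_coe, mul_one, ← Complex.ofReal_one,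
        ← Complex.ofReal_sub, Complex.norm_real, Real.norm_eq_abs, abs_sub_comm,
        abs_of_nonneg (by linarith [hr1 k])]
    refine ⟨h1.trans_lt (hr1 k), ?_⟩
    rw [h1, h2]
    linarith [hr1 k]

section energy

variable {μ : Measure Circle}

lemma normSq_sub_le (u : Circle → ℂ) {v : Circle → ℂ} (hv : Measurable v) :
    normSq μ (fun ζ => u ζ - v ζ) ≤ 2 * normSq μ u + 2 * normSq μ v := by
  have h1 : ∫⁻ ζ, ‖u ζ - v ζ‖ₑ ^ 2 ∂arcMeasure
      ≤ 2 * (∫⁻ ζ, ‖u ζ‖ₑ ^ 2 ∂arcMeasure) + 2 * ∫⁻ ζ, ‖v ζ‖ₑ ^ 2 ∂arcMeasure := by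
    rw [← lintegral_const_mul' _ _ (by norm_num), ← lintegral_const_mul' _ _ (by norm_num),
      ← lintegral_add_right _ ((hv.enorm.pow_const 2).const_mul 2)]
    refine lintegral_mono fun ζ => ?_
    rw [sub_eq_add_neg, ← enorm_neg (v ζ)]
    exact enorm_add_sq_le _ _
  have h2 : dirichletIntegral μ (fun ζ => u ζ - v ζ)
      ≤ 2 * dirichletIntegral μ u + 2 * dirichletIntegral μ v := by
    unfold dirichletIntegral
    rw [← lintegral_const_mul' _ _ (by norm_num), ← lintegral_const_mul' _ _ (by norm_num),
      ← lintegral_add_right _ ((measurable_localDirichlet hv).const_mul 2)]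
    exact lintegral_mono fun ξ => localDirichlet_sub_le u hv ξ
  unfold normSq
  refine (add_le_add h1 h2).trans_eq ?_
  ring

lemma localEnergy_le_normSq (J : Set Circle) (v : Circle → ℂ) :
    localEnergy μ J v ≤ normSq μ v :=
  add_le_add (setLIntegral_le_lintegral _ _)
    (lintegral_mono fun _ => setLIntegral_le_lintegral _ _)

lemma localEnergy_le_add (J : Set Circle) (u : Circle → ℂ) {v : Circle → ℂ} (hv : Measurable v) :
    localEnergy μ J u ≤ 2 * localEnergy μ J v + 2 * localEnergy μ J (fun ζ => u ζ - v ζ) := by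
  have h1 : ∫⁻ ζ in J, ‖u ζ‖ₑ ^ 2 ∂arcMeasure
      ≤ 2 * (∫⁻ ζ in J, ‖v ζ‖ₑ ^ 2 ∂arcMeasure)
        + 2 * ∫⁻ ζ in J, ‖u ζ - v ζ‖ₑ ^ 2 ∂arcMeasure := by
    rw [← lintegral_const_mul' _ _ (by norm_num), ← lintegral_const_mul' _ _ (by norm_num),
      ← lintegral_add_left ((hv.enorm.pow_const 2).const_mul 2)]
    refine lintegral_mono fun ζ => ?_
    have := enorm_add_sq_le (v ζ) (u ζ - v ζ)
    rwa [add_sub_cancel] at this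
  have hdm : Measurable fun p : Circle × Circle => diffQuot v p.1 p.2 :=
    measurable_diffQuot_uncurry hv
  have h2 : ∫⁻ ξ, ∫⁻ ζ in J, ‖diffQuot u ξ ζ‖ₑ ^ 2 ∂arcMeasure ∂μ
      ≤ 2 * (∫⁻ ξ, ∫⁻ ζ in J, ‖diffQuot v ξ ζ‖ₑ ^ 2 ∂arcMeasure ∂μ)
        + 2 * ∫⁻ ξ, ∫⁻ ζ in J, ‖diffQuot (fun ζ => u ζ - v ζ) ξ ζ‖ₑ ^ 2 ∂arcMeasure ∂μ := by
    rw [← lintegral_const_mul' _ _ (by norm_num), ← lintegral_const_mul' _ _ (by norm_num),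
      ← lintegral_add_left ((hdm.enorm.pow_const 2).lintegral_prod_right'.const_mul 2)]
    refine lintegral_mono fun ξ => ?_
    rw [← lintegral_const_mul' _ _ (by norm_num), ← lintegral_const_mul' _ _ (by norm_num),
      ← lintegral_add_left (((measurable_diffQuot hv ξ).enorm.pow_const 2).const_mul 2)]
    refine lintegral_mono fun ζ => ?_
    have := enorm_add_sq_le (diffQuot v ξ ζ) (diffQuot (fun ζ => u ζ - v ζ) ξ ζ)
    convert this using 3
    simp only [diffQuot]; ring
  unfold localEnergy
  refine (add_le_add h1 h2).trans_eq ?_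
  ring

/-- The local energies of `f` on disjoint sets add up to at most `‖f‖_μ²`. -/
lemma sum_localEnergy_le_normSq {J : ℕ → Set Circle} (hJ : ∀ n, MeasurableSet (J n))
    (hd : Pairwise fun m n => Disjoint (J m) (J n)) {f : Circle → ℂ} (hf : Measurable f)
    (s : Finset ℕ) : ∑ n ∈ s, localEnergy μ (J n) f ≤ normSq μ f := by
  have hset : ∀ h : Circle → ℝ≥0∞,
      ∑ n ∈ s, ∫⁻ ζ in J n, h ζ ∂arcMeasure ≤ ∫⁻ ζ, h ζ ∂arcMeasure := by
    intro h
    rw [← lintegral_biUnion_finset (fun m _ n _ hmn => hd hmn) (fun n _ => hJ n)]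
    exact setLIntegral_le_lintegral _ _
  unfold localEnergy
  rw [Finset.sum_add_distrib, ← lintegral_finsetSum _ fun n _ => by
    have := (measurable_diffQuot_uncurry hf).enorm.pow_const 2
    exact Measurable.lintegral_prod_right' (ν := arcMeasure.restrict (J n)) this]
  exact add_le_add (hset _) (lintegral_mono fun ξ => hset _)

/-- If `f ∈ 𝒟(μ)` vanishes quasi-everywhere on `E`, the local capacity estimate, which is about
sublevel sets of continuous functions, extends to `f` and `E ∩ I`: some dilations `u_k` of `f`
converge to `f` so fast that, by the weak type inequality, they converge uniformly outside open
sets of small capacity, hence on `E ∩ I` the function `u_K` is small except on a set of small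
capacity. -/
lemma capacity_inter_le {I J : Set Circle} {ρ M : ℝ} (hI : IsOpen I) (hρ : 0 < ρ) (hρ1 : ρ ≤ 1)
    (hM : 0 ≤ M) (hfar : ∀ ζ, ζ ∉ J → 2 * ρ ≤ Metric.infDist ζ I)
    (hdiam : ∀ ζ ∈ J, ∀ ζ' ∈ J, dist ζ ζ' ≤ M * ρ) (hJ : MeasurableSet J)
    (hm : ENNReal.ofReal ρ ≤ arcMeasure J) {E : Set Circle} {f : Circle → ℂ}
    (hf : f ∈ analyticSpace μ)
    (hE : QuasiEverywhereOn μ E fun ζ => HasNontangentialLimit (discExtension f) ζ 0)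
    (hpos : 0 < (arcMeasure.real J)⁻¹ * ∫ ζ in J, ‖f ζ‖ ∂arcMeasure) :
    capacity μ (E ∩ I)
      ≤ ENNReal.ofReal (((arcMeasure.real J)⁻¹ * ∫ ζ in J, ‖f ζ‖ ∂arcMeasure)⁻¹ ^ 2)
        * (ENNReal.ofReal (localConst M) * (2 * localEnergy μ J f)) := by
  obtain ⟨N, hN, hEN⟩ := hE
  have hr := exists_seq_strictMono_tendsto' (show (0 : ℝ) < 1 from one_pos)
  obtain ⟨r, -, hr01, hr⟩ := hr
  have hr0 : ∀ k, 0 ≤ r k := fun k => (hr01 k).1.le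
  have hr1 : ∀ k, r k < 1 := fun k => (hr01 k).2
  have hlim := tendsto_normSq_dilation_sub μ hf hr0 hr1 hr
  obtain ⟨φ, hφ, hφs⟩ : ∃ φ : ℕ → ℕ, StrictMono φ ∧ ∀ k,
      normSq μ (fun ζ => dilation (r (φ k)) f ζ - f ζ) ≤ ENNReal.ofReal ((1 / 16) ^ k) := by
    refine extraction_forall_of_eventually (P := fun k n =>
      normSq μ (fun ζ => dilation (r n) f ζ - f ζ) ≤ ENNReal.ofReal ((1 / 16) ^ k)) fun k => ?_
    exact hlim.eventually_le_const (ENNReal.ofReal_pos.2 (by positivity))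
  set u : ℕ → Circle → ℂ := fun k => dilation (r (φ k)) f with hu
  have huc : ∀ k, Continuous (u k) := fun k => continuous_dilation (hr0 _) (hr1 _) f
  have hfm : Measurable f := hf.1.1
  have hdiff : ∀ k, normSq μ (fun ζ => u (k + 1) ζ - u k ζ)
      ≤ ENNReal.ofReal (4 * (1 / 16) ^ k) := by
    intro k
    have h1 := normSq_sub_le (μ := μ) (fun ζ => u (k + 1) ζ - f ζ)
      (v := fun ζ => u k ζ - f ζ) ((huc k).measurable.sub hfm)
    simp only [sub_sub_sub_cancel_right] at h1
    refine h1.trans ((add_le_add (mul_le_mul' le_rfl (hφs (k + 1)))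
      (mul_le_mul' le_rfl (hφs k))).trans ?_)
    rw [← ENNReal.ofReal_ofNat, ← ENNReal.ofReal_mul (by norm_num),
      ← ENNReal.ofReal_mul (by norm_num), ← ENNReal.ofReal_add (by positivity) (by positivity)]
    refine ENNReal.ofReal_le_ofReal ?_
    have : (0 : ℝ) ≤ (1 / 16) ^ k := by positivity
    rw [pow_succ]
    linarith
  have hW : ∀ k, capacity μ {ζ | (1 / 2) ^ k < ‖u (k + 1) ζ - u k ζ‖}
      ≤ ENNReal.ofReal (4 * (1 / 4) ^ k) := by
    intro k
    refine (capacity_lt_norm_le ((huc _).sub (huc _)) (by positivity)).trans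
      ((mul_le_mul' le_rfl (hdiff k)).trans ?_)
    rw [← ENNReal.ofReal_mul (by positivity)]
    refine ENNReal.ofReal_le_ofReal (le_of_eq ?_)
    have e : (((1 / 2 : ℝ) ^ k)⁻¹) ^ 2 * (1 / 16) ^ k = (1 / 4) ^ k := by
      rw [← inv_pow, ← pow_mul, mul_comm k 2, pow_mul, ← mul_pow]
      norm_num
    rw [← e]
    ring
  have hsub : ∀ K, E ∩ I ⊆ (N ∪ ⋃ k, {ζ | (1 / 2) ^ (K + k) < ‖u (K + k + 1) ζ - u (K + k) ζ‖})
      ∪ (I ∩ {ζ | ‖u K ζ‖ < 4 * (1 / 2) ^ K}) := by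
    rintro K ζ ⟨hζE, hζI⟩
    by_cases h : ζ ∈ N ∪ ⋃ k, {ζ | (1 / 2) ^ (K + k) < ‖u (K + k + 1) ζ - u (K + k) ζ‖}
    · exact Or.inl h
    refine Or.inr ⟨hζI, ?_⟩
    simp only [Set.mem_union, Set.mem_iUnion, Set.mem_ofPred_eq, not_or, not_exists, not_lt] at h
    have h1 : Tendsto (fun k => u (K + k) ζ) atTop (𝓝 0) := by
      have h2 := tendsto_dilation_of_hasNontangentialLimit (hEN ζ hζE h.1) hr0 hr1 hr
      have h3 := h2.comp hφ.tendsto_atTop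
      simpa only [Function.comp_def, add_comm] using (tendsto_add_atTop_iff_nat K).2 h3
    have h4 := dist_le_of_le_geometric_two_of_tendsto₀ (C := 2 * (1 / 2) ^ K) (fun k => by
      rw [dist_comm, dist_eq_norm]
      refine (h.2 k).trans_eq ?_
      rw [pow_add, one_div_pow 2 k]
      ring) h1
    rw [dist_zero_right, add_zero] at h4
    have : (0 : ℝ) < (1 / 2) ^ K := by positivity
    simp only [Set.mem_ofPred_eq]
    linarith
  set m := (arcMeasure.real J)⁻¹ * ∫ ζ in J, ‖f ζ‖ ∂arcMeasure with hmdef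
  set mK : ℕ → ℝ := fun K => (arcMeasure.real J)⁻¹ * ∫ ζ in J, ‖u K ζ‖ ∂arcMeasure with hmK
  have hmlim : Tendsto mK atTop (𝓝 m) := by
    refine (tendsto_setIntegral_norm_of_sq (fun k => (huc k).measurable) hfm
      (fun k => ((huc k).memLp_arcMeasure 1).integrable le_rfl)
      (hf.1.2.1.integrable (by norm_num)) ?_ J).const_mul _
    refine tendsto_of_tendsto_of_tendsto_of_le_of_le tendsto_const_nhds
      (hlim.comp hφ.tendsto_atTop) (fun _ => zero_le) fun k => ?_
    exact le_self_add
  have hδlim : Tendsto (fun K : ℕ => (4 : ℝ) * (1 / 2) ^ K) atTop (𝓝 0) := by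
    simpa using (tendsto_pow_atTop_nhds_zero_of_lt_one (by norm_num) (by norm_num :
      (1 / 2 : ℝ) < 1)).const_mul (4 : ℝ)
  have hbound : ∀ᶠ K in atTop, capacity μ (E ∩ I) ≤ ∑' k, ENNReal.ofReal (4 * (1 / 4) ^ (K + k))
      + ENNReal.ofReal ((mK K - 4 * (1 / 2) ^ K)⁻¹ ^ 2) * (ENNReal.ofReal (localConst M) *
        (2 * localEnergy μ J f + 2 * ENNReal.ofReal ((1 / 16) ^ K))) := by
    have h1 : ∀ᶠ K in atTop, 4 * (1 / 2) ^ K < mK K := by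
      have := (hmlim.sub hδlim).eventually_const_lt (u := 0) (by simpa using hpos)
      filter_upwards [this] with K hK
      linarith
    filter_upwards [h1] with K hK
    refine (capacity_mono (hsub K)).trans ((capacity_union_le _ _).trans (add_le_add ?_ ?_))
    · refine (capacity_union_le _ _).trans ?_
      rw [hN, zero_add]
      exact (capacity_iUnion_le _).trans (ENNReal.tsum_le_tsum fun k => hW (K + k))
    · refine (capacity_sublevel_le μ hI hρ hρ1 hM hfar hdiam hJ hm (huc K) hK).trans ?_
      refine mul_le_mul' le_rfl (mul_le_mul' le_rfl ?_)
      refine (localEnergy_le_add J (u K) hfm).trans (add_le_add le_rfl ?_)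
      exact mul_le_mul' le_rfl ((localEnergy_le_normSq J _).trans (hφs K))
  refine ge_of_tendsto ?_ hbound
  have ht1 : Tendsto (fun K : ℕ => ∑' k, ENNReal.ofReal (4 * (1 / 4) ^ (K + k))) atTop (𝓝 0) := by
    have hs : Summable fun k : ℕ => (4 : ℝ) * (1 / 4) ^ k :=
      (summable_geometric_of_lt_one (by norm_num) (by norm_num)).mul_left 4
    have := ENNReal.tendsto_sum_nat_add (fun k => ENNReal.ofReal (4 * (1 / 4) ^ k))
      (by rw [← ENNReal.ofReal_tsum_of_nonneg (fun _ => by positivity) hs]; finiteness)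
    simpa only [add_comm] using this
  have ht2 : Tendsto (fun K => ENNReal.ofReal ((mK K - 4 * (1 / 2) ^ K)⁻¹ ^ 2)) atTop
      (𝓝 (ENNReal.ofReal (m⁻¹ ^ 2))) := by
    refine ENNReal.tendsto_ofReal (((hmlim.sub hδlim).inv₀ ?_).pow 2 |>.congr' ?_ |>.trans ?_)
    · simpa using hpos.ne'
    · exact Eventually.of_forall fun _ => rfl
    · rw [sub_zero]
  have ht3 : Tendsto (fun K : ℕ => 2 * localEnergy μ J f + 2 * ENNReal.ofReal ((1 / 16) ^ K)) atTop
      (𝓝 (2 * localEnergy μ J f)) := by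
    have h1 : Tendsto (fun K : ℕ => ENNReal.ofReal ((1 / 16) ^ K)) atTop (𝓝 0) := by
      simpa using ENNReal.tendsto_ofReal (tendsto_pow_atTop_nhds_zero_of_lt_one (by norm_num)
        (by norm_num : (1 / 16 : ℝ) < 1))
    have h2 := ENNReal.Tendsto.const_mul (a := 2) h1 (Or.inr (by norm_num))
    simpa using h2.const_add (2 * localEnergy μ J f)
  have hfin : localEnergy μ J f ≠ ∞ :=
    ((localEnergy_le_normSq J f).trans_lt (normSq_lt_top_of_mem hf.1)).ne
  have ht4 := ENNReal.Tendsto.const_mul (a := ENNReal.ofReal (localConst M)) ht3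
    (Or.inr (by finiteness))
  have ht5 := ENNReal.Tendsto.mul ht2 (Or.inr (by finiteness)) ht4 (Or.inr (by finiteness))
  simpa using ht1.add ht5

end energy

/-! ### Logarithmic means of analytic functions -/

lemma analyticOnNhd_discExtension (f : Circle → ℂ) :
    AnalyticOnNhd ℂ (discExtension f) (Metric.ball 0 1) := by
  intro z hz
  rw [mem_ball_zero_iff] at hz
  obtain ⟨R, hzR, hR1⟩ := exists_between hz
  have hR0 : 0 ≤ R := (norm_nonneg z).trans hzR.le
  have hd : DifferentiableOn ℂ (discExtension f) (Metric.ball 0 R) := by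
    unfold discExtension
    refine Complex.differentiableOn_tsum_of_summable_norm
      (u := fun n : ℕ => ‖fourierCoefficient f n * (R : ℂ) ^ n‖)
      (summable_norm_discExtension f (by simpa [abs_of_nonneg hR0] using hR1))
      (fun n => by fun_prop) Metric.isOpen_ball fun n w hw => ?_
    rw [mem_ball_zero_iff] at hw
    rw [norm_mul, norm_mul, norm_pow, norm_pow, Complex.norm_real, Real.norm_of_nonneg hR0]
    gcongr
  exact hd.analyticOnNhd Metric.isOpen_ball z (by simpa using hzR)

lemma discExtension_zero (f : Circle → ℂ) : discExtension f 0 = fourierCoefficient f 0 := by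
  unfold discExtension
  rw [tsum_eq_single 0]
  · simp
  · intro n hn
    simp [hn]

/-- Jensen's inequality for an analytic function; `ε` makes the logarithm harmless at the zeros. -/
lemma log_norm_le_circleAverage {F : ℂ → ℂ} {r : ℝ} (hr : 0 < r)
    (hF : AnalyticOnNhd ℂ F (Metric.closedBall 0 r)) (h0 : F 0 ≠ 0) {ε : ℝ} (hε : 0 < ε) :
    Real.log ‖F 0‖ ≤ Real.circleAverage (fun z => Real.log (‖F z‖ + ε)) 0 r := by
  classical
  have hF' : AnalyticOnNhd ℂ F (Metric.closedBall 0 |r|) := by rwa [abs_of_pos hr]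
  have hJ := hF'.circleAverage_log_norm hr.ne' h0
  have h1 : Real.log ‖F 0‖ ≤ Real.circleAverage (fun z => Real.log ‖F z‖) 0 r := by
    rw [hJ]
    refine le_add_of_nonneg_left (finsum_nonneg fun u => ?_)
    by_cases hu : u ∈ Metric.closedBall (0 : ℂ) |r|
    · refine mul_nonneg (mod_cast MeromorphicOn.AnalyticOnNhd.divisor_nonneg hF' u) ?_
      rcases eq_or_ne u 0 with rfl | hu0
      · simp
      · refine Real.log_nonneg ?_
        rw [zero_sub, norm_neg, ← div_eq_mul_inv, one_le_div (norm_pos_iff.2 hu0)]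
        simpa [abs_of_pos hr] using hu
    · simp [hu]
  refine h1.trans ?_
  -- `log ‖F z‖` takes the junk value `0` at the zeros of `F`, which form a discrete set
  have hne : ∀ᶠ x in codiscreteWithin (Metric.sphere (0 : ℂ) |r|), F x ≠ 0 := by
    refine codiscreteWithin_mono Metric.sphere_subset_closedBall ?_
    refine (hF'.eqOn_zero_or_eventually_ne_zero_of_preconnected
      (convex_closedBall _ _).isPreconnected).resolve_left fun h => h0 ?_
    exact h (by simp)
  set h : ℂ → ℝ := fun z => if F z = 0 then Real.log ε else Real.log ‖F z‖ with hh
  have heq : (fun z => Real.log ‖F z‖) =ᶠ[codiscreteWithin (Metric.sphere (0 : ℂ) |r|)] h := by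
    filter_upwards [hne] with x hx
    rw [hh]; simp only [if_neg hx]
  rw [Real.circleAverage_congr_codiscreteWithin heq hr.ne']
  have hFs : AnalyticOnNhd ℂ F (Metric.sphere 0 |r|) := hF'.mono Metric.sphere_subset_closedBall
  refine Real.circleAverage_mono
    (hFs.meromorphicOn.circleIntegrable_log_norm.congr_codiscreteWithin heq) ?_ fun x _ => ?_
  · have hFs' : ContinuousOn F (Metric.sphere 0 r) := by
      have := hFs.continuousOn
      rwa [abs_of_pos hr] at this
    refine ContinuousOn.circleIntegrable hr.le ((hFs'.norm.add continuousOn_const).log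
      fun x _ => (add_pos_of_nonneg_of_pos (norm_nonneg _) hε).ne')
  · simp only [hh]
    split_ifs with hx
    · simp [hx]
    · have := norm_pos_iff.2 hx
      exact Real.log_le_log this (by linarith)

lemma abs_log_add_sub_log_add_le {x y ε : ℝ} (hx : 0 ≤ x) (hy : 0 ≤ y) (hε : 0 < ε) :
    |Real.log (x + ε) - Real.log (y + ε)| ≤ ε⁻¹ * |x - y| := by
  wlog hxy : y ≤ x generalizing x y
  · rw [abs_sub_comm, abs_sub_comm x]
    exact this hy hx (le_of_not_ge hxy)
  have h1 : Real.log (y + ε) ≤ Real.log (x + ε) := Real.log_le_log (by linarith) (by linarith)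
  rw [abs_of_nonneg (by linarith), abs_of_nonneg (by linarith),
    ← Real.log_div (by positivity) (by positivity)]
  refine (Real.log_le_sub_one_of_pos (by positivity)).trans ?_
  have h2 : (x + ε) / (y + ε) - 1 = (y + ε)⁻¹ * (x - y) := by
    field_simp; ring
  rw [h2]
  have : (y + ε)⁻¹ ≤ ε⁻¹ := inv_anti₀ hε (by linarith)
  exact mul_le_mul_of_nonneg_right this (by linarith)

lemma integrable_log_norm_add {f : Circle → ℂ} (hf : Integrable f arcMeasure) {ε : ℝ} (hε : 0 < ε) :
    Integrable (fun ζ => Real.log (‖f ζ‖ + ε)) arcMeasure := by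
  have h1 : Integrable (fun ζ => Real.log (‖f ζ‖ + ε) - Real.log ε) arcMeasure := by
    refine Integrable.mono' (hf.norm.const_mul ε⁻¹) ?_ (Eventually.of_forall fun ζ => ?_)
    · exact ((Real.measurable_log.comp_aemeasurable
        (hf.1.norm.aemeasurable.add_const ε)).aestronglyMeasurable).sub aestronglyMeasurable_const
    · have := abs_log_add_sub_log_add_le (norm_nonneg (f ζ)) le_rfl hε
      simpa using this
  refine (h1.add (integrable_const (Real.log ε))).congr (Eventually.of_forall fun ζ => ?_)
  simp

lemma log_norm_fourierCoefficient_zero_le {f : Circle → ℂ} (hf : Measurable f)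
    (hf2 : MemLp f 2 arcMeasure) (hneg : ∀ n : ℤ, n < 0 → fourierCoefficient f n = 0)
    (h0 : fourierCoefficient f 0 ≠ 0) {ε : ℝ} (hε : 0 < ε) :
    Real.log ‖fourierCoefficient f 0‖ ≤ ∫ ζ, Real.log (‖f ζ‖ + ε) ∂arcMeasure := by
  obtain ⟨r, -, hr01, hr⟩ := exists_seq_strictMono_tendsto' (show (0 : ℝ) < 1 from one_pos)
  have hr0 : ∀ k, 0 ≤ r k := fun k => (hr01 k).1.le
  have hr1 : ∀ k, r k < 1 := fun k => (hr01 k).2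
  have hfi : Integrable f arcMeasure := hf2.integrable (by norm_num)
  have hdi : ∀ k, Integrable (dilation (r k) f) arcMeasure := fun k =>
    ((continuous_dilation (hr0 k) (hr1 k) f).memLp_arcMeasure 1).integrable le_rfl
  have hle : ∀ k, Real.log ‖fourierCoefficient f 0‖
      ≤ ∫ ζ, Real.log (‖dilation (r k) f ζ‖ + ε) ∂arcMeasure := by
    intro k
    have h1 := log_norm_le_circleAverage (hr01 k).1 ((analyticOnNhd_discExtension f).mono
      (Metric.closedBall_subset_ball (hr1 k))) (by rwa [discExtension_zero]) hε
    rwa [discExtension_zero, circleAverage_eq_integral_arcMeasure] at h1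
  refine ge_of_tendsto' (f := fun k => ∫ ζ, Real.log (‖dilation (r k) f ζ‖ + ε) ∂arcMeasure)
    (x := atTop) ?_ hle
  refine tendsto_integral_of_L1 _ (integrable_log_norm_add hfi hε).1
    (Eventually.of_forall fun k => integrable_log_norm_add (hdi k) hε) ?_
  have h2 := tendsto_lintegral_enorm_of_sq (h := fun k ζ => dilation (r k) f ζ - f ζ)
    (fun k => (continuous_dilation (hr0 k) (hr1 k) f).measurable.sub hf)
    (tendsto_lintegral_dilation_sub hf2 hneg hr0 hr1 hr)
  have h3 := ENNReal.Tendsto.const_mul (a := ENNReal.ofReal ε⁻¹) h2 (Or.inr (by finiteness))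
  rw [mul_zero] at h3
  refine tendsto_of_tendsto_of_tendsto_of_le_of_le tendsto_const_nhds h3 (fun _ => zero_le)
    fun k => ?_
  simp only
  rw [← lintegral_const_mul' _ _ (by finiteness)]
  refine lintegral_mono fun ζ => ?_
  rw [← ofReal_norm, ← ofReal_norm, ← ENNReal.ofReal_mul (by positivity)]
  refine ENNReal.ofReal_le_ofReal ?_
  refine (abs_log_add_sub_log_add_le (norm_nonneg _) (norm_nonneg _) hε).trans ?_
  gcongr
  exact abs_norm_sub_norm_le _ _

/-- A nonzero analytic function has logarithmic means bounded below. -/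
lemma exists_le_integral_log_norm_add {f : Circle → ℂ} (hf : Measurable f)
    (hf2 : MemLp f 2 arcMeasure) (hneg : ∀ n : ℤ, n < 0 → fourierCoefficient f n = 0)
    (hne : ¬ f =ᵐ[arcMeasure] 0) :
    ∃ L : ℝ, ∀ ε : ℝ, 0 < ε → L ≤ ∫ ζ, Real.log (‖f ζ‖ + ε) ∂arcMeasure := by
  classical
  have hex : ∃ k : ℕ, fourierCoefficient f k ≠ 0 := by
    by_contra! h
    refine hne ?_
    have h1 : ∀ n : ℤ, fourierCoefficient f n = 0 := by
      intro n
      rcases lt_or_ge n 0 with hn | hn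
      · exact hneg n hn
      · lift n to ℕ using hn
        exact h n
    have h2 := lintegral_enorm_sq_eq_tsum hf2
    simp only [h1] at h2
    simp only [enorm_zero, ne_eq, OfNat.ofNat_ne_zero, not_false_eq_true, zero_pow, tsum_zero] at h2
    rw [lintegral_eq_zero_iff (hf.enorm.pow_const 2)] at h2
    filter_upwards [h2] with ζ hζ
    simpa using hζ
  -- dividing by the monomial of the lowest frequency makes the mean value nonzero
  set k := Nat.find hex with hk
  have hc : ∀ n : ℤ, fourierCoefficient (fun ζ => f ζ * (ζ : ℂ) ^ (-(k : ℤ))) n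
      = fourierCoefficient f (n + k) := fun n => by
    rw [fourierCoefficient_mul_zpow, sub_neg_eq_add]
  have hm : Measurable fun ζ : Circle => f ζ * (ζ : ℂ) ^ (-(k : ℤ)) :=
    hf.mul (continuous_coe_zpow _).measurable
  have hn : ∀ ζ : Circle, ‖f ζ * (ζ : ℂ) ^ (-(k : ℤ))‖ = ‖f ζ‖ := fun ζ => by
    rw [norm_mul, norm_coe_zpow, mul_one]
  refine ⟨Real.log ‖fourierCoefficient f k‖, fun ε hε => ?_⟩
  have h := log_norm_fourierCoefficient_zero_le (f := fun ζ => f ζ * (ζ : ℂ) ^ (-(k : ℤ))) hm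
    (hf2.of_le hm.aestronglyMeasurable (Eventually.of_forall fun ζ => (hn ζ).le)) (fun n hn0 => ?_)
    ?_ hε
  · simpa only [hc, hn, zero_add] using h
  · rw [hc]
    rcases lt_or_ge (n + k) 0 with h | h
    · exact hneg _ h
    · obtain ⟨j, hj⟩ := Int.eq_ofNat_of_zero_le h
      have hjk : j < k := by omega
      have := Nat.find_min hex hjk
      rw [hj]
      exact not_not.1 this
  · rw [hc, zero_add]
    exact Nat.find_spec hex

/-- By concavity of the logarithm, lower bounds on the logarithmic means of `f` give lower bounds on
the means of `|f|` over disjoint sets. -/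
lemma sum_measure_mul_log_mean_ge {f : Circle → ℂ} (hfi : Integrable f arcMeasure) {L ε : ℝ}
    (hε : 0 < ε) (hε1 : ε ≤ 1) (hL : L ≤ ∫ ζ, Real.log (‖f ζ‖ + ε) ∂arcMeasure)
    {J : ℕ → Set Circle} (hJ : ∀ n, MeasurableSet (J n))
    (hd : Pairwise fun m n => Disjoint (J m) (J n)) (hJ0 : ∀ n, arcMeasure.real (J n) ≠ 0)
    (s : Finset ℕ) :
    L - ∫ ζ, ‖f ζ‖ ∂arcMeasure ≤ ∑ n ∈ s, arcMeasure.real (J n) *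
      Real.log ((arcMeasure.real (J n))⁻¹ * (∫ ζ in J n, ‖f ζ‖ ∂arcMeasure) + ε) := by
  have hli := integrable_log_norm_add hfi hε
  set U := ⋃ n ∈ s, J n with hU
  have hUm : MeasurableSet U := s.measurableSet_biUnion fun n _ => hJ n
  have h1 := integral_add_compl hUm hli
  have h2 : ∫ ζ in Uᶜ, Real.log (‖f ζ‖ + ε) ∂arcMeasure ≤ ∫ ζ, ‖f ζ‖ ∂arcMeasure := by
    refine (setIntegral_mono hli.integrableOn hfi.norm.integrableOn fun ζ => ?_).trans
      (setIntegral_le_integral hfi.norm (Eventually.of_forall fun _ => norm_nonneg _))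
    have := Real.log_le_sub_one_of_pos (show 0 < ‖f ζ‖ + ε by positivity)
    simp only
    linarith
  have h3 : ∫ ζ in U, Real.log (‖f ζ‖ + ε) ∂arcMeasure
      = ∑ n ∈ s, ∫ ζ in J n, Real.log (‖f ζ‖ + ε) ∂arcMeasure :=
    integral_biUnion_finset s (fun n _ => hJ n) (fun m _ n _ hmn => hd hmn)
      fun n _ => hli.integrableOn
  have h4 : ∀ n, ∫ ζ in J n, Real.log (‖f ζ‖ + ε) ∂arcMeasure ≤ arcMeasure.real (J n) *
      Real.log ((arcMeasure.real (J n))⁻¹ * (∫ ζ in J n, ‖f ζ‖ ∂arcMeasure) + ε) := by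
    intro n
    have hint : 0 ≤ ∫ ζ in J n, ‖f ζ‖ ∂arcMeasure := integral_nonneg fun _ => norm_nonneg _
    set c := (arcMeasure.real (J n))⁻¹ * (∫ ζ in J n, ‖f ζ‖ ∂arcMeasure) + ε with hc
    have hc0 : 0 < c := by positivity
    have h5 : ∀ ζ, Real.log (‖f ζ‖ + ε) ≤ c⁻¹ * ‖f ζ‖ + (Real.log c + c⁻¹ * ε - 1) := by
      intro ζ
      have hp : 0 < ‖f ζ‖ + ε := by positivity
      have := Real.log_le_sub_one_of_pos (div_pos hp hc0)
      rw [Real.log_div hp.ne' hc0.ne'] at this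
      have e : (‖f ζ‖ + ε) / c = c⁻¹ * ‖f ζ‖ + c⁻¹ * ε := by field_simp
      linarith
    have hi : Integrable (fun ζ => c⁻¹ * ‖f ζ‖ + (Real.log c + c⁻¹ * ε - 1)) arcMeasure :=
      (hfi.norm.const_mul c⁻¹).add (integrable_const _)
    refine (setIntegral_mono hli.integrableOn hi.integrableOn h5).trans_eq ?_
    rw [integral_add (hfi.norm.const_mul c⁻¹).integrableOn (integrable_const _),
      integral_const_mul, setIntegral_const, smul_eq_mul]
    have e : ∫ ζ in J n, ‖f ζ‖ ∂arcMeasure = arcMeasure.real (J n) * (c - ε) := by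
      rw [hc, add_sub_cancel_right, mul_inv_cancel_left₀ (hJ0 n)]
    rw [e]
    field_simp
    ring
  have h5 := Finset.sum_le_sum (s := s) fun n _ => h4 n
  linarith

lemma mean_pos_and_sum_measure_mul_log_mean_ge {f : Circle → ℂ} (hfi : Integrable f arcMeasure)
    {L : ℝ} (hL : ∀ ε : ℝ, 0 < ε → L ≤ ∫ ζ, Real.log (‖f ζ‖ + ε) ∂arcMeasure)
    {J : ℕ → Set Circle} (hJ : ∀ n, MeasurableSet (J n))
    (hd : Pairwise fun m n => Disjoint (J m) (J n)) (hJ0 : ∀ n, arcMeasure.real (J n) ≠ 0) :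
    (∀ n, 0 < (arcMeasure.real (J n))⁻¹ * ∫ ζ in J n, ‖f ζ‖ ∂arcMeasure) ∧
    ∀ s : Finset ℕ, L - ∫ ζ, ‖f ζ‖ ∂arcMeasure ≤ ∑ n ∈ s, arcMeasure.real (J n) *
      Real.log ((arcMeasure.real (J n))⁻¹ * ∫ ζ in J n, ‖f ζ‖ ∂arcMeasure) := by
  have key := fun (s : Finset ℕ) (ε : ℝ) (hε : 0 < ε) (hε1 : ε ≤ 1) =>
    sum_measure_mul_log_mean_ge hfi hε hε1 (hL ε hε) hJ hd hJ0 s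
  have hlim : Tendsto (fun k : ℕ => 1 / ((k : ℝ) + 1)) atTop (𝓝 0) :=
    tendsto_one_div_add_atTop_nhds_zero_nat
  have hε : ∀ k : ℕ, 0 < 1 / ((k : ℝ) + 1) := fun k => by positivity
  have hε1 : ∀ k : ℕ, 1 / ((k : ℝ) + 1) ≤ 1 := fun k => by
    rw [div_le_one (by positivity)]
    linarith [(Nat.cast_nonneg k : (0 : ℝ) ≤ k)]
  have hpos : ∀ n, 0 < (arcMeasure.real (J n))⁻¹ * ∫ ζ in J n, ‖f ζ‖ ∂arcMeasure := by
    intro n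
    have hJn : 0 < arcMeasure.real (J n) := lt_of_le_of_ne measureReal_nonneg (hJ0 n).symm
    have hint : 0 ≤ ∫ ζ in J n, ‖f ζ‖ ∂arcMeasure := integral_nonneg fun _ => norm_nonneg _
    refine (Real.exp_pos ((arcMeasure.real (J n))⁻¹ * (L - ∫ ζ, ‖f ζ‖ ∂arcMeasure))).trans_le ?_
    have h1 : Tendsto (fun k : ℕ => (arcMeasure.real (J n))⁻¹ * (∫ ζ in J n, ‖f ζ‖ ∂arcMeasure)
        + 1 / ((k : ℝ) + 1)) atTop
        (𝓝 ((arcMeasure.real (J n))⁻¹ * ∫ ζ in J n, ‖f ζ‖ ∂arcMeasure)) := by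
      simpa using hlim.const_add ((arcMeasure.real (J n))⁻¹ * ∫ ζ in J n, ‖f ζ‖ ∂arcMeasure)
    refine ge_of_tendsto' h1 fun k => ?_
    have h2 := key {n} _ (hε k) (hε1 k)
    rw [Finset.sum_singleton] at h2
    rw [← Real.le_log_iff_exp_le (by have := hε k; positivity), inv_mul_le_iff₀ hJn]
    exact h2
  refine ⟨hpos, fun s => ?_⟩
  refine ge_of_tendsto' (f := fun k : ℕ => ∑ n ∈ s, arcMeasure.real (J n) *
      Real.log ((arcMeasure.real (J n))⁻¹ * (∫ ζ in J n, ‖f ζ‖ ∂arcMeasure) + 1 / ((k : ℝ) + 1)))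
    (x := atTop) ?_ fun k => key s _ (hε k) (hε1 k)
  refine tendsto_finsetSum _ fun n _ => Tendsto.const_mul _ ?_
  refine Tendsto.log ?_ (hpos n).ne'
  simpa using hlim.const_add ((arcMeasure.real (J n))⁻¹ * ∫ ζ in J n, ‖f ζ‖ ∂arcMeasure)

/-! ### The uniqueness theorem -/

lemma ereal_coe_sum {ι : Type*} (s : Finset ι) (x : ι → ℝ) :
    ((∑ i ∈ s, x i : ℝ) : EReal) = ∑ i ∈ s, (x i : EReal) := by
  classical
  induction s using Finset.induction_on with
  | empty => simp
  | insert i s hi ih => rw [Finset.sum_insert hi, Finset.sum_insert hi, EReal.coe_add, ih]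

/-- A bound `c(E ∩ I) ≤ K d / m²` bounds the term `|I| log (|I| / c(E ∩ I))` from below, because
`x ≤ exp x` for `x = K d / |I|`. -/
lemma le_capacityTerm {μ : Measure Circle} {E : Set Circle} {a b m k : ℝ} (hab : a < b)
    (hm : 0 < m) (h : capacity μ (E ∩ arc a b) ≤ ENNReal.ofReal (m⁻¹ ^ 2 * k)) :
    ((2 * (b - a) * Real.log m - k : ℝ) : EReal) ≤ capacityTerm μ E a b := by
  have hl : 0 < b - a := sub_pos.2 hab
  set y := 2 * Real.log m - k / (b - a) with hy
  have hexp : Real.exp y = m ^ 2 * Real.exp (-(k / (b - a))) := by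
    rw [hy, sub_eq_add_neg, Real.exp_add, mul_comm 2, Real.exp_mul, Real.exp_log hm]
    norm_num
  have h1 : ENNReal.ofReal (Real.exp y) ≤ ENNReal.ofReal (b - a) / capacity μ (E ∩ arc a b) := by
    rw [ENNReal.le_div_iff_mul_le (Or.inr (ENNReal.ofReal_pos.2 hl).ne') (Or.inr (by finiteness))]
    refine (mul_le_mul' le_rfl h).trans ?_
    rw [← ENNReal.ofReal_mul (Real.exp_pos _).le]
    refine ENNReal.ofReal_le_ofReal ?_
    have h2 : k / (b - a) ≤ Real.exp (k / (b - a)) := by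
      linarith [Real.add_one_le_exp (k / (b - a))]
    have h3 : k ≤ (b - a) * Real.exp (k / (b - a)) := by
      rwa [div_le_iff₀' hl] at h2
    rw [hexp, Real.exp_neg]
    calc m ^ 2 * (Real.exp (k / (b - a)))⁻¹ * (m⁻¹ ^ 2 * k)
        = (Real.exp (k / (b - a)))⁻¹ * k := by field_simp
      _ ≤ b - a := by
        rw [inv_mul_le_iff₀ (Real.exp_pos _), mul_comm]
        exact h3
  have h4 := ENNReal.log_monotone h1
  rw [ENNReal.log_ofReal_of_pos (Real.exp_pos _), Real.log_exp] at h4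
  have h5 : 2 * (b - a) * Real.log m - k = (b - a) * y := by
    rw [hy]; field_simp
  rw [h5, EReal.coe_mul, capacityTerm]
  exact mul_le_mul_of_nonneg_left h4 (by exact_mod_cast hl.le)

end

end HarmonicDirichlet

open HarmonicDirichlet

theorem theorem1p1 (μ : Measure Circle) [IsFiniteMeasure μ]
    (E : Set Circle) (hE : MeasurableSet E)
    (γ : ℝ) (hγ : 1 < γ) (a b : ℕ → ℝ)
    (hab : ∀ n, a n < b n ∧ b n ≤ a n + 2 * Real.pi)
    (hdisj : Pairwise fun m n : ℕ =>
      Disjoint (HarmonicDirichlet.enlargedArc γ (a m) (b m))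
        (HarmonicDirichlet.enlargedArc γ (a n) (b n)))
    (hsum : Tendsto
      (fun N : ℕ => ∑ n ∈ Finset.range N, HarmonicDirichlet.capacityTerm μ E (a n) (b n))
      atTop (𝓝 (⊥ : EReal))) :
    HarmonicDirichlet.IsUniquenessSet μ E := by
  intro f hf hqe
  by_contra hne
  have hfm : Measurable f := hf.1.1
  have hfi : Integrable f arcMeasure := hf.1.2.1.integrable (by norm_num)
  obtain ⟨L, hL⟩ := exists_le_integral_log_norm_add hfm hf.1.2.1 hf.2 hne
  have hπ := Real.pi_pos
  have hl : ∀ n, 0 < b n - a n := fun n => sub_pos.2 (hab n).1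
  set J : ℕ → Set Circle := fun n => enlargedArc γ (a n) (b n) with hJdef
  have hJm : ∀ n, MeasurableSet (J n) := fun n => (isOpen_enlargedArc _ _ _).measurableSet
  -- `γ I_n` is not the whole circle, as it is disjoint from the next arc
  have hlen : ∀ n, γ * (b n - a n) ≤ 2 * Real.pi := by
    intro n
    refine length_le_of_enlargedArc_ne_univ fun h => ?_
    have h1 : Disjoint (enlargedArc γ (a n) (b n)) (enlargedArc γ (a (n + 1)) (b (n + 1))) :=
      hdisj (Nat.succ_ne_self n).symm
    rw [h, Set.univ_disjoint] at h1
    exact (nonempty_enlargedArc hγ (hab (n + 1)).1).ne_empty h1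
  have hmeas : ∀ n, arcMeasure.real (J n) = γ * (b n - a n) / (2 * Real.pi) := by
    intro n
    have := hl n
    rw [measureReal_def, hJdef, arcMeasure_enlargedArc (hlen n),
      ENNReal.toReal_ofReal (by positivity)]
  have hJ0 : ∀ n, arcMeasure.real (J n) ≠ 0 := fun n => by
    have := hl n
    rw [hmeas]; positivity
  obtain ⟨hpos, hlog⟩ := mean_pos_and_sum_measure_mul_log_mean_ge hfi hL hJm hdisj hJ0
  set m : ℕ → ℝ := fun n => (arcMeasure.real (J n))⁻¹ * ∫ ζ in J n, ‖f ζ‖ ∂arcMeasure with hmdef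
  set M := 2 * Real.pi * γ / (γ - 1) with hMdef
  have hγ1 : 0 < γ - 1 := by linarith
  have hM : 0 ≤ M := by positivity
  set K := 2 * localConst M with hK
  have hC0 : 0 ≤ localConst M := by unfold localConst; positivity
  have hfin : ∀ n, localEnergy μ (J n) f ≠ ∞ := fun n =>
    ((localEnergy_le_normSq (J n) f).trans_lt (normSq_lt_top_of_mem hf.1)).ne
  set d : ℕ → ℝ := fun n => (localEnergy μ (J n) f).toReal with hd
  have hcap : ∀ n, capacity μ (E ∩ arc (a n) (b n))
      ≤ ENNReal.ofReal ((m n)⁻¹ ^ 2 * (K * d n)) := by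
    intro n
    have hln := hl n
    have hρ : 0 < (γ - 1) * (b n - a n) / (2 * Real.pi) := by positivity
    have hγl : (γ - 1) * (b n - a n) ≤ γ * (b n - a n) := by nlinarith
    refine (capacity_inter_le (I := arc (a n) (b n)) (J := J n)
      (ρ := (γ - 1) * (b n - a n) / (2 * Real.pi)) (M := M) (isOpen_arc _ _) hρ
      ?_ hM (fun ζ hζ => le_infDist_of_notMem_enlargedArc hγ (hab n).1 hζ) ?_ (hJm n) ?_ hf hqe
      (hpos n)).trans_eq ?_
    · rw [div_le_one (by positivity)]
      exact hγl.trans (hlen n)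
    · intro ζ hζ ξ hξ
      refine (dist_le_of_mem_enlargedArc hζ hξ).trans_eq ?_
      rw [hMdef]; field_simp
    · rw [hJdef, arcMeasure_enlargedArc (hlen n)]
      refine ENNReal.ofReal_le_ofReal ?_
      gcongr
    · rw [ENNReal.ofReal_mul (by positivity), hK, mul_comm 2 (localConst M), mul_assoc,
        ENNReal.ofReal_mul hC0, ENNReal.ofReal_mul (by norm_num), ENNReal.ofReal_ofNat, hd,
        ENNReal.ofReal_toReal (hfin n)]
  have hlow : ∀ N : ℕ, ((4 * Real.pi / γ * (L - ∫ ζ, ‖f ζ‖ ∂arcMeasure)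
      - K * (normSq μ f).toReal : ℝ) : EReal)
      ≤ ∑ n ∈ Finset.range N, capacityTerm μ E (a n) (b n) := by
    intro N
    refine le_trans ?_ (Finset.sum_le_sum fun n _ => le_capacityTerm (hab n).1 (hpos n) (hcap n))
    rw [← ereal_coe_sum, EReal.coe_le_coe_iff, Finset.sum_sub_distrib, ← Finset.mul_sum]
    have h1 : ∑ n ∈ Finset.range N, d n ≤ (normSq μ f).toReal := by
      rw [hd, ← ENNReal.toReal_sum fun n _ => hfin n]
      exact ENNReal.toReal_mono (normSq_lt_top_of_mem hf.1).ne
        (sum_localEnergy_le_normSq hJm hdisj hfm _)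
    have h2 : ∑ n ∈ Finset.range N, 2 * (b n - a n) * Real.log (m n) = 4 * Real.pi / γ *
        ∑ n ∈ Finset.range N, arcMeasure.real (J n) * Real.log (m n) := by
      rw [Finset.mul_sum]
      refine Finset.sum_congr rfl fun n _ => ?_
      rw [hmeas]; field_simp
      ring
    have hK0 : 0 ≤ K := by positivity
    rw [h2]
    gcongr
    exact hlog _
  obtain ⟨N, hN⟩ := (hsum.eventually_lt_const (EReal.bot_lt_coe (4 * Real.pi / γ *
    (L - ∫ ζ, ‖f ζ‖ ∂arcMeasure) - K * (normSq μ f).toReal))).exists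
  exact absurd (hlow N) (not_le.2 hN)
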